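/- **String-net model.** Let $\{0,\dots,N\}$ be a set of string types with an involution $i\mapsto i^*$, $0^*=0$, and let $\delta_{ijk}\in\{0,1\}$ be branching rules, symmetric in $i,j,k$, with $\delta_{ij^*0}=\delta_{ij}$. Let $F^{ijm}_{kln}\in\mathbb{C}$ be a tensor with $F^{ii^*0}_{ii^*0}\neq 0$ for all $i$. Put $d_i=1/F^{ii^*0}_{ii^*0}$, and assume for all values of the indices (with principal square roots) physicality $F^{ijm}_{kln}\delta_{ijm}\delta_{klm^*}=F^{ijm}_{kln}\delta_{iln}\delta_{jkn^*}$; the pentagon identity $\sum_n F^{mlq}_{kpn}F^{jip^*}_{mns}F^{jsn}_{lkr}=F^{jip^*}_{q^*kr}F^{r^*iq^*}_{mls}$; unitarity $\overline{F^{ijm}_{kln}}=F^{i^*j^*m^*}_{k^*l^*n^*}$; tetrahedral symmetry $F^{ijm}_{kln}=F^{jim}_{lkn^*}=F^{lkm^*}_{jin}=F^{imj}_{k^*nl}\sqrt{d_md_n/(d_jd_l)}$; and normalization $F^{ii^*0}_{j^*jk}=\sqrt{d_k/(d_id_j)}\,\delta_{ijk}$. **Graphs.** Let $\mathcal G$ be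 a finite trivalent graph (loops and multiple edges allowed) embedded in a closed oriented surface such that every component of the complement (a *plaquette*) is simply connected. $\mathcal H_{\mathcal G}$ is the Hilbert space whose orthonormal basis consists of all labelings of the edges of $\mathcal G$ by string types, where reversing the direction of an edge replaces its label $i$ by $i^*$. **F-moves.** Let $e$ be an edge of $\mathcal G$ with two distinct endpoints $v,w$. Let $m$ be the label of $e$ directed towards $v$, let $e,i,j$ be the counterclockwise order at $v$ and $e,k,l$ that at $w$, where $i,j,k,l$ are the labels of the other edges directed towards $v$, respectively $w$. The graph $\mathcal G'=F_e(\mathcal G)$ is obtained by reconnecting $e$ so that the counterclockwise orders at its two ends become $e,l,i$ and $e,j,k$, and $F_e:\mathcal H_{\mathcal G}\to\mathcal H_{\mathcal G'}$ is the linear map $F_e|ijkl;m\rangle=\sum_n F^{ijm}_{kln}|ijkl;n\rangle$, where $n$ is the label of the new edge directed towards the end with the edges $l,i$, and all other labels are unchanged. Every plaquette $p$ of $\mathcal G$ corresponds to the plaquette $p'$ of $\mathcal G'$ that lies on the same sides of the edges other than $e$. **Plaquette operators.** For a plaquette $p$, the operator $B_p^i$ on $\mathcal H_{\mathcal G}$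 adds a counterclockwise loop of type $i$ inside $p$, fused into the boundary of $p$: at a corner of $p$ with inward labels $c$ on the boundary edge entering the corner (in the counterclockwise traversal of the boundary of $p$), $b$ on the boundary edge leaving it and $a$ on the third edge, $b,c$ are replaced by $b',c'$ with the factor $F^{abc}_{i^*c'b'}$. The factors of all corners of $p$ are multiplied, the new labels at the two ends of each side are identified, and one sums over all new labels. If $p$ lies on both sides of some edge, that edge is relabeled twice, once for each side, in an order that is chosen for each edge such that the three orders at a vertex are not cyclic; each corner uses the labels found when it is processed, and the intermediate labels are summed over too. Such a choice of orders always exists. Put $B_p=\sum_i d_iB_p^i\big/\sum_i d_i^2$. **Lemma.** For every such $\mathcal G$, every edge $e$ of $\mathcal G$ that is not a loop, every plaquette $p$ of $\mathcal G$, and all choices of orders in the definitions of $B_p$ and $B_{p'}$, $$F_e\,B_p=B_{p'}\,F_e$$ as linear maps $\mathcal H_{\mathcal G}\to\mathcal H_{\mathcal G'}$, where $\mathcal G'=F_e(\mathcal G)$ and $p'$ is the plaquette of $\mathcal G'$ that corresponds to $p$. So F-moves intertwine the plaquette operators. -/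

import Mathlib

open Equiv Equiv.Perm

noncomputable section

/-! ### The algebraic data of a string-net model -/

/-- String types `0, …, N` (where `0` is the absence of a string) with duality `i ↦ i*`,
branching rules, and a tensor `F`, where `F i j m k l n` stands for `F^{ijm}_{kln}`. -/
structure StringData (N : ℕ) where
  /-- the dual string type -/
  star : Fin (N + 1) → Fin (N + 1)
  /-- the triples of string types that may meet at a vertex (all strings pointing inwards) -/
  Allowed : Fin (N + 1) → Fin (N + 1) → Fin (N + 1) → Prop
  /-- the tensor `F^{ijm}_{kln}` -/
  F : Fin (N + 1) → Fin (N + 1) → Fin (N + 1) → Fin (N + 1) → Fin (N + 1) → Fin (N + 1) → ℂ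

namespace StringData

variable {N : ℕ} (M : StringData N)

open Classical in
/-- The branching tensor: `δ_{ijk}` is `1` on allowed triples and `0` otherwise. -/
def δ (i j k : Fin (N + 1)) : ℂ := if M.Allowed i j k then 1 else 0

/-- The quantum dimension `d_i = 1 / F^{i i* 0}_{i i* 0}`. -/
def d (i : Fin (N + 1)) : ℂ := (M.F i (M.star i) 0 i (M.star i) 0)⁻¹

end StringData

/-- A string-net model: the string types, branching rules and tensor `F` satisfy the
self-consistency conditions. Square roots are principal square roots, `√z = z ^ (1 / 2)`. -/
structure StringNetModel (N : ℕ) extends StringData N where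
  star_star : ∀ i, star (star i) = i
  star_zero : star 0 = 0
  allowed_rotate : ∀ i j k, Allowed i j k → Allowed j k i
  allowed_swap : ∀ i j k, Allowed i j k → Allowed j i k
  allowed_zero : ∀ i j, Allowed i (star j) 0 ↔ i = j
  F_ne_zero : ∀ i, F i (star i) 0 i (star i) 0 ≠ 0
  physicality : ∀ i j k l m n,
    F i j m k l n * toStringData.δ i j m * toStringData.δ k l (star m) =
      F i j m k l n * toStringData.δ i l n * toStringData.δ j k (star n)
  pentagon : ∀ i j k l m p q r s,
    ∑ n, F m l q k p n * F j i (star p) m n s * F j s n l k r =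
      F j i (star p) (star q) k r * F (star r) i (star q) m l s
  unitarity : ∀ i j k l m n,
    (starRingEnd ℂ) (F i j m k l n) = F (star i) (star j) (star m) (star k) (star l) (star n)
  tetrahedral₁ : ∀ i j k l m n, F i j m k l n = F j i m l k (star n)
  tetrahedral₂ : ∀ i j k l m n, F i j m k l n = F l k (star m) j i n
  tetrahedral₃ : ∀ i j k l m n,
    F i j m k l n = F i m j (star k) n l *
      (toStringData.d m * toStringData.d n / (toStringData.d j * toStringData.d l)) ^ (1 / 2 : ℂ)
  normalization : ∀ i j k,
    F i (star i) 0 (star j) j k =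
      (toStringData.d k / (toStringData.d i * toStringData.d j)) ^ (1 / 2 : ℂ) *
        toStringData.δ i j k

/-! ### Trivalent graphs embedded in oriented surfaces -/

/-- A finite trivalent graph embedded in a closed oriented surface such that the components of the
complement are simply connected, up to orientation-preserving homeomorphism (for a finite `D`).
`D` is the set of darts (half-edges). A dart is attached to one vertex and points away from it;
`σ d` is the next dart counterclockwise around the same vertex (so vertices are the orbits of `σ`,
all of size three), and `α d` is the other half of the edge of `d`. Loops and multiple edges are
allowed. -/
structure TrivalentMap (D : Type*) where
  /-- counterclockwise rotation around the vertices -/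
  σ : Perm D
  /-- exchange of the two halves of every edge -/
  α : Perm D
  σ_cubed : ∀ d, σ (σ (σ d)) = d
  σ_ne : ∀ d, σ d ≠ d
  α_α : ∀ d, α (α d) = d
  α_ne : ∀ d, α d ≠ d

namespace TrivalentMap

variable {D : Type*} (G : TrivalentMap D)

/-- `φ d` is the dart that follows `d` when the boundary of the plaquette on the left-hand side
of `d` is traversed counterclockwise. -/
def φ : Perm D := G.σ⁻¹ * G.α

/-- The plaquettes: a plaquette is given by its boundary walk, an orbit of `φ`. -/
def Plaquette : Type _ := Quotient (SameCycle.setoid G.φ)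

/-- The plaquette on the left-hand side of the dart `d`. It contains the corner between `d` and
`σ d`; every corner of every plaquette is of this form for exactly one `d`. -/
def face (d : D) : G.Plaquette := Quotient.mk (SameCycle.setoid G.φ) d

/-- The edge of `e` is a loop, i.e. its two ends are at the same vertex. -/
def IsLoop (e : D) : Prop := G.σ.SameCycle e (G.α e)

/-- The standard string-net configurations: `ℓ d` is the type of the string on the edge of `d`
when this edge is directed towards the vertex of `d`; reversing the direction dualizes the type.
(So a configuration amounts to the choice of one string type per edge, once the edges are
oriented.) -/
def Labeling {N : ℕ} (M : StringNetModel N) : Type _ :=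
  {ℓ : D → Fin (N + 1) // ∀ d, ℓ (G.α d) = M.star (ℓ d)}

instance {N : ℕ} (M : StringNetModel N) : CoeFun (G.Labeling M) (fun _ => D → Fin (N + 1)) :=
  ⟨Subtype.val⟩

instance {N : ℕ} (M : StringNetModel N) [Fintype D] : Fintype (G.Labeling M) := by
  classical
  unfold Labeling
  infer_instance

instance {N : ℕ} (M : StringNetModel N) : DecidableEq (G.Labeling M) :=
  Classical.decEq _

/-- The Hilbert space of the string-net model on `G`, with the string-net configurations as
orthonormal basis. -/
abbrev Hilbert {N : ℕ} (M : StringNetModel N) [Fintype D] : Type _ :=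
  EuclideanSpace ℂ (G.Labeling M)

theorem sigma_inv (d : D) : G.σ⁻¹ d = G.σ (G.σ d) := by
  rw [Perm.inv_eq_iff_eq, G.σ_cubed]

theorem phi_apply (d : D) : G.φ d = G.σ (G.σ (G.α d)) := by
  rw [φ, Perm.mul_apply, sigma_inv]

theorem isLoop_of_alpha_eq_sigma {e : D} (h : G.α e = G.σ e) : G.IsLoop e :=
  ⟨1, by simp [h]⟩

theorem isLoop_of_alpha_eq_sigma_sigma {e : D} (h : G.α e = G.σ (G.σ e)) : G.IsLoop e :=
  ⟨2, by rw [h]; rfl⟩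

theorem face_phi (d : D) : G.face (G.φ d) = G.face d :=
  Quotient.sound (s := SameCycle.setoid G.φ) (sameCycle_apply_left.2 (SameCycle.refl _ _))

theorem sigma_sigma_ne (d : D) : G.σ (G.σ d) ≠ d := fun h =>
  G.σ_ne d (by conv_lhs => rw [← h, G.σ_cubed])

theorem ne_of_not_isLoop {e : D} (he : ¬ G.IsLoop e) :
    (G.α e ≠ e ∧ G.α e ≠ G.σ e ∧ G.α e ≠ G.σ (G.σ e)) ∧
    (G.σ (G.α e) ≠ e ∧ G.σ (G.α e) ≠ G.σ e ∧ G.σ (G.α e) ≠ G.σ (G.σ e)) ∧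
    (G.σ (G.σ (G.α e)) ≠ e ∧ G.σ (G.σ (G.α e)) ≠ G.σ e ∧
      G.σ (G.σ (G.α e)) ≠ G.σ (G.σ e)) := by
  have h1 : G.α e ≠ G.σ e := fun h => he (G.isLoop_of_alpha_eq_sigma h)
  have h2 : G.α e ≠ G.σ (G.σ e) := fun h => he (G.isLoop_of_alpha_eq_sigma_sigma h)
  have h0 := G.α_ne e
  have inj := G.σ.injective
  have c := G.σ_cubed
  refine ⟨⟨h0, h1, h2⟩, ⟨?_, ?_, ?_⟩, ⟨?_, ?_, ?_⟩⟩
  · intro h; apply h2; conv_rhs => rw [← h, c]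
  · intro h; exact h0 (inj h)
  · intro h; exact h1 (inj h)
  · intro h; apply h1; conv_rhs => rw [← h, c]
  · intro h; apply h2; conv_rhs => rw [← inj h, c]
  · intro h; exact h0 (inj (inj h))

/-! ### F-moves -/

section FMove

variable [DecidableEq D] (e : D)

/-- The cyclic shift `σ e → σ² (α e) → σ (α e) → σ² e → σ e` of the four legs of the edge of `e`
(when this edge is not a loop). -/
def legShift : Perm D :=
  swap (G.σ e) (G.σ (G.σ (G.α e))) * swap (G.σ (G.σ (G.α e))) (G.σ (G.α e)) *
    swap (G.σ (G.α e)) (G.σ (G.σ e))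

/-- The graph obtained by reconnecting the edge of `e` (a flip of the dual edge). If the legs
are `i = σ e`, `j = σ² e` at the vertex of `e` and `k = σ (α e)`, `l = σ² (α e)` at the other
vertex, then the counterclockwise orders `(e, i, j)`, `(α e, k, l)` at the two vertices become
`(e, l, i)`, `(α e, j, k)`. -/
def fmove : TrivalentMap D where
  σ := G.legShift e * G.σ * (G.legShift e)⁻¹
  α := G.α
  σ_cubed d := by simp [G.σ_cubed]
  σ_ne d h := by
    apply G.σ_ne ((G.legShift e)⁻¹ d)
    rw [Perm.mul_apply, Perm.mul_apply] at h
    rw [Perm.eq_inv_iff_eq, h]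
  α_α := G.α_α
  α_ne := G.α_ne

variable {e}

theorem legShift_apply (he : ¬ G.IsLoop e) :
    G.legShift e e = e ∧ G.legShift e (G.σ e) = G.σ (G.σ (G.α e)) ∧
    G.legShift e (G.σ (G.σ e)) = G.σ e ∧ G.legShift e (G.α e) = G.α e ∧
    G.legShift e (G.σ (G.α e)) = G.σ (G.σ e) ∧
    G.legShift e (G.σ (G.σ (G.α e))) = G.σ (G.α e) := by
  obtain ⟨⟨h0, h1, h2⟩, ⟨h3, h4, h5⟩, ⟨h6, h7, h8⟩⟩ := G.ne_of_not_isLoop he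
  have a1 := G.σ_ne e
  have a2 := G.σ_ne (G.σ e)
  have a3 := G.sigma_sigma_ne e
  have b1 := G.σ_ne (G.α e)
  have b2 := G.σ_ne (G.σ (G.α e))
  have b3 := G.sigma_sigma_ne (G.α e)
  refine ⟨?_, ?_, ?_, ?_, ?_, ?_⟩ <;>
    simp only [legShift, Perm.mul_apply, swap_apply_def] <;> grind

theorem legShift_apply_of_ne {x : D} (h1 : x ≠ G.σ e) (h2 : x ≠ G.σ (G.σ e))
    (h3 : x ≠ G.σ (G.α e)) (h4 : x ≠ G.σ (G.σ (G.α e))) : G.legShift e x = x := by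
  simp only [legShift, Perm.mul_apply, swap_apply_def]
  grind

theorem fmove_sigma_legShift (x : D) :
    (G.fmove e).σ (G.legShift e x) = G.legShift e (G.σ x) := by
  simp [fmove]

theorem fmove_phi_eq {d y : D} (h : (G.fmove e).σ y = G.α d) : (G.fmove e).φ d = y := by
  rw [φ, Perm.mul_apply, Perm.inv_eq_iff_eq]
  exact h.symm

open Classical in
/-- A dart on the boundary of the plaquette of `d` that does not belong to the edge of `e`. -/
def offEdge (e d : D) : D := if d = e ∨ d = G.α e then G.φ d else d

theorem face_offEdge_phi (he : ¬ G.IsLoop e) (d : D) :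
    (G.fmove e).face (G.offEdge e (G.φ d)) = (G.fmove e).face (G.offEdge e d) := by
  obtain ⟨⟨h0, h1, h2⟩, ⟨h3, h4, h5⟩, ⟨h6, h7, h8⟩⟩ := G.ne_of_not_isLoop he
  have a1 := G.σ_ne e
  have a2 := G.σ_ne (G.σ e)
  have a3 := G.sigma_sigma_ne e
  have b1 := G.σ_ne (G.α e)
  have b2 := G.σ_ne (G.σ (G.α e))
  have b3 := G.sigma_sigma_ne (G.α e)
  obtain ⟨p1, p2, p3, p4, p5, p6⟩ := G.legShift_apply he
  have s1 := G.fmove_sigma_legShift (e := e) e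
  have s2 := G.fmove_sigma_legShift (e := e) (G.σ e)
  have s3 := G.fmove_sigma_legShift (e := e) (G.σ (G.σ e))
  have s4 := G.fmove_sigma_legShift (e := e) (G.α e)
  have s5 := G.fmove_sigma_legShift (e := e) (G.σ (G.α e))
  have s6 := G.fmove_sigma_legShift (e := e) (G.σ (G.σ (G.α e)))
  rw [G.σ_cubed] at s3 s6
  rw [p1, p2] at s1
  rw [p2, p3] at s2
  rw [p3, p1] at s3
  rw [p4, p5] at s4
  rw [p5, p6] at s5
  rw [p6, p4] at s6
  have hp := G.phi_apply
  have c := G.σ_cubed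
  have step := (G.fmove e).face_phi
  by_cases hd : d = e ∨ d = G.α e
  · have : ¬ (G.φ d = e ∨ G.φ d = G.α e) := by
      rcases hd with rfl | rfl
      · rw [hp]; rintro (h | h)
        · exact h6 h
        · exact b3 h
      · rw [hp, G.α_α]; rintro (h | h)
        · exact a3 h
        · exact h2 h.symm
    rw [offEdge, if_neg this, offEdge, if_pos hd]
  rw [not_or] at hd
  have hd' : G.offEdge e d = d := by rw [offEdge, if_neg (by tauto)]
  rw [hd']
  by_cases c1 : G.α d = G.σ e
  · -- the boundary walk passes through `e`, which it leaves after the move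
    have q : G.φ d = e := by rw [hp, c1, c]
    rw [offEdge, if_pos (Or.inl q), q, hp, ← step d, G.fmove_phi_eq (s2.trans c1.symm)]
  by_cases c2 : G.α d = G.σ (G.α e)
  · have q : G.φ d = G.α e := by rw [hp, c2, c]
    rw [offEdge, if_pos (Or.inr q), q, hp, G.α_α, ← step d, G.fmove_phi_eq (s5.trans c2.symm)]
  have hn : ¬ (G.φ d = e ∨ G.φ d = G.α e) := by
    rw [hp]; rintro (h | h)
    · exact c1 (by rw [← h, c])
    · exact c2 (by rw [← h, c])
  rw [offEdge, if_neg hn]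
  by_cases c3 : G.α d = G.σ (G.σ e)
  · have q : G.φ d = G.σ e := by rw [hp, c3, c]
    have r1 : (G.fmove e).φ d = G.α e := G.fmove_phi_eq (s4.trans c3.symm)
    have r2 : (G.fmove e).φ (G.α e) = G.σ e := G.fmove_phi_eq (s3.trans (G.α_α e).symm)
    rw [q, ← step d, r1, ← r2, step]
  by_cases c4 : G.α d = G.σ (G.σ (G.α e))
  · have q : G.φ d = G.σ (G.α e) := by rw [hp, c4, c]
    have r1 : (G.fmove e).φ d = e := G.fmove_phi_eq (s1.trans c4.symm)
    have r2 : (G.fmove e).φ e = G.σ (G.α e) := G.fmove_phi_eq s6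
    rw [q, ← step d, r1, ← r2, step]
  have c5 : G.α d ≠ e := fun h => hd.2 (by rw [← h, G.α_α])
  have c6 : G.α d ≠ G.α e := fun h => hd.1 (G.α.injective h)
  have r : (G.fmove e).φ d = G.φ d := by
    apply G.fmove_phi_eq
    have t := G.fmove_sigma_legShift (e := e) (G.φ d)
    rw [G.legShift_apply_of_ne, hp, c, G.legShift_apply_of_ne c1 c3 c2 c4] at t
    · rw [hp, t]
    all_goals rw [hp]; intro h
    · exact c3 (by rw [← h, c])
    · exact c5 (by rw [← c (G.α d), h, c])
    · exact c4 (by rw [← h, c])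
    · exact c6 (by rw [← c (G.α d), h, c])
  rw [← r, step]

/-- The plaquette of the reconnected graph that corresponds to a given plaquette: both lie on the
left-hand side of the same darts outside the reconnected edge. -/
def movePlaquette (he : ¬ G.IsLoop e) (p : G.Plaquette) : (G.fmove e).Plaquette :=
  Quotient.lift (s := SameCycle.setoid G.φ) (fun d => (G.fmove e).face (G.offEdge e d)) (by
    rintro a b ⟨k, rfl⟩
    symm
    induction k using Int.induction_on generalizing a with
    | zero => rfl
    | succ n ih => rw [zpow_add_one, Perm.mul_apply, ih, G.face_offEdge_phi he]
    | pred n ih =>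
      rw [zpow_sub_one, Perm.mul_apply, ih, ← G.face_offEdge_phi he, ← Perm.mul_apply, mul_inv_cancel, Perm.one_apply]) p

theorem movePlaquette_face (he : ¬ G.IsLoop e) {d : D} (h1 : d ≠ e) (h2 : d ≠ G.α e) :
    G.movePlaquette he (G.face d) = (G.fmove e).face d := by
  change (G.fmove e).face (G.offEdge e d) = _
  rw [offEdge, if_neg (by tauto)]

variable (e)

open Classical in
/-- The linear map of an F-move. It only changes the label `m` of the edge of `e`, and
`|i j k l; m⟩ ↦ ∑ n, F^{ijm}_{kln} |i j k l; n⟩`, where `i`, `j`, `k`, `l` are the labels of the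
legs `σ e`, `σ² e`, `σ (α e)`, `σ² (α e)`, directed towards the edge of `e`, and where `m` and `n`
are directed towards the vertex of `e`. -/
def fmoveOp {N : ℕ} (M : StringNetModel N) [Fintype D] :
    G.Hilbert M →ₗ[ℂ] (G.fmove e).Hilbert M :=
  Matrix.toEuclideanLin (Matrix.of fun (ℓ' : (G.fmove e).Labeling M) (ℓ : G.Labeling M) =>
    if ∀ x, x ≠ e → x ≠ G.α e → ℓ' x = ℓ x then
      M.F (ℓ (G.σ e)) (ℓ (G.σ (G.σ e))) (ℓ e)
        (ℓ (G.σ (G.α e))) (ℓ (G.σ (G.σ (G.α e)))) (ℓ' e)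
    else 0)

end FMove

/-! ### Plaquette operators -/

/-- For every edge an order of its two sides: a loop inside the plaquette on the left-hand side of
`d` is fused into the edge of `d` before a loop inside the plaquette on the other side if and only
if `first d` holds. At a vertex, the three orders must not be cyclic. The order is relevant only
for edges that have the same plaquette on both sides. -/
structure FusionOrder where
  first : D → Bool
  first_alpha : ∀ d, first (G.α d) = !first d
  acyclic : ∀ d, ¬ (first d = first (G.σ d) ∧ first d = first (G.σ (G.σ d)))

/-- Two fixed-point free involutions have a common proper 2-colouring. -/
theorem exists_coloring {E : Type*} (a b : Perm E) (ha : ∀ x, a (a x) = x) (hb : ∀ x, b (b x) = x)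
    (ha' : ∀ x, a x ≠ x) (hb' : ∀ x, b x ≠ x) :
    ∃ f : E → Bool, (∀ x, f (a x) = !f x) ∧ ∀ x, f (b x) = !f x := by
  classical
  have hinv : ∀ x, (a * b)⁻¹ x = b (a x) := fun x => by
    rw [Perm.inv_eq_iff_eq, Perm.mul_apply, hb, ha]
  have hconj : ∀ (k : ℤ) x, a (((a * b) ^ k) x) = ((a * b) ^ (-k)) (a x) := by
    intro k
    induction k using Int.induction_on with
    | zero => intro x; simp
    | succ n ih =>
      intro x
      rw [zpow_add_one, Perm.mul_apply, ih, neg_add, zpow_add, Perm.mul_apply _ _ (a x),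
        zpow_neg_one, hinv, Perm.mul_apply, ha, ha]
    | pred n ih =>
      intro x
      rw [zpow_sub_one, Perm.mul_apply, ih, hinv,
        show -(-(n : ℤ) - 1) = - -(n : ℤ) + 1 by ring, zpow_add_one, Perm.mul_apply,
        Perm.mul_apply]
  have hnot : ∀ x, ¬ SameCycle (a * b) x (a x) := by
    rintro x ⟨k, hk⟩
    rcases Int.even_or_odd' k with ⟨m, rfl | rfl⟩
    · apply ha' (((a * b) ^ m) x)
      rw [hconj, ← hk, ← Perm.mul_apply, ← zpow_add]
      congr 2; ring
    · apply hb' (((a * b) ^ m) x)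
      have : a (b (((a * b) ^ m) x)) = a (((a * b) ^ m) x) := by
        rw [hconj, ← hk, ← Perm.mul_apply a b, ← Perm.mul_apply, ← zpow_one_add, ← Perm.mul_apply,
          ← zpow_add]
        congr 2; ring
      exact a.injective this
  let Q := Quotient (SameCycle.setoid (a * b))
  let mk : E → Q := Quotient.mk _
  have hmk : ∀ x, mk (b x) = mk (a x) := fun x =>
    Quotient.sound (s := SameCycle.setoid (a * b)) ⟨1, by
      rw [zpow_one, Perm.mul_apply, hb]⟩
  have hmk' : ∀ x, mk (a (b x)) = mk x := fun x =>
    Quotient.sound (s := SameCycle.setoid (a * b)) ⟨-1, by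
      rw [zpow_neg_one, hinv, ha, hb]⟩
  have hne : ∀ x, mk x ≠ mk (a x) := fun x h =>
    hnot x (Quotient.exact (s := SameCycle.setoid (a * b)) h)
  let r : Q → Q → Prop := WellOrderingRel
  have hr : ∀ x, r (mk (a x)) (mk x) ↔ ¬ r (mk x) (mk (a x)) := by
    intro x
    refine ⟨fun h h' => asymm_of r h h', fun h => ?_⟩
    rcases trichotomous_of r (mk x) (mk (a x)) with h' | h' | h'
    · exact absurd h' h
    · exact absurd h' (hne x)
    · exact h'
  refine ⟨fun x => decide (r (mk x) (mk (a x))), fun x => ?_, fun x => ?_⟩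
  · beta_reduce
    rw [ha, ← decide_not, decide_eq_decide, hr]
  · beta_reduce
    rw [hmk, hmk', ← decide_not, decide_eq_decide, hr]

/-- A fusion order exists for every trivalent map. -/
theorem FusionOrder.nonempty : Nonempty G.FusionOrder := by
  classical
  have hmem : ∀ (k : ℤ) d, (G.σ ^ k) d = d ∨ (G.σ ^ k) d = G.σ d ∨ (G.σ ^ k) d = G.σ (G.σ d) := by
    intro k d
    have c := G.σ_cubed d
    induction k using Int.induction_on with
    | zero => simp
    | succ n ih =>
      rw [add_comm, zpow_one_add, Perm.mul_apply]
      rcases ih with h | h | h <;> rw [h] <;> simp [c]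
    | pred n ih =>
      rw [sub_eq_neg_add, zpow_add, zpow_neg_one, Perm.mul_apply, sigma_inv]
      rcases ih with h | h | h <;> rw [h] <;> simp [c]
  -- a distinguished dart at every vertex; the other two are to be coloured differently
  obtain ⟨t, ht, hσ⟩ : ∃ t : D → D, (∀ d, t d = d ∨ t d = G.σ d ∨ t d = G.σ (G.σ d)) ∧
      ∀ d, t (G.σ d) = t d := by
    refine ⟨fun d => (Quotient.mk (SameCycle.setoid G.σ) d).out, fun d => ?_, fun d => ?_⟩
    · obtain ⟨k, hk⟩ := Quotient.exact (s := SameCycle.setoid G.σ)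
        (Quotient.out_eq (Quotient.mk (SameCycle.setoid G.σ) d)).symm
      beta_reduce
      rw [← hk]
      exact hmem k d
    · exact congrArg Quotient.out (Quotient.sound (s := SameCycle.setoid G.σ)
        (sameCycle_apply_left.2 (SameCycle.refl _ _)))
  have c := G.σ_cubed
  have n1 := G.σ_ne
  have n2 := G.sigma_sigma_ne
  let b₀ : D × Bool → D × Bool := fun x =>
    if t x.1 = x.1 then (x.1, !x.2) else if t x.1 = G.σ x.1 then (G.σ (G.σ x.1), x.2)
      else (G.σ x.1, x.2)
  have hb : ∀ x, b₀ (b₀ x) = x := by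
    rintro ⟨d, ε⟩
    rcases ht d with h | h | h <;> simp [b₀, h, hσ, c, n1, n2, (n1 _).symm]
  have hb' : ∀ x, b₀ x ≠ x := by
    rintro ⟨d, ε⟩
    rcases ht d with h | h | h <;> simp [b₀, h, n1, n2]
  let a₀ : D × Bool → D × Bool := fun x => (G.α x.1, x.2)
  have ha : ∀ x, a₀ (a₀ x) = x := fun x => by simp [a₀, G.α_α]
  obtain ⟨f, fa, fb⟩ := exists_coloring ⟨a₀, a₀, ha, ha⟩ ⟨b₀, b₀, hb, hb⟩ ha hb
    (fun x h => G.α_ne x.1 (congrArg Prod.fst h)) hb'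
  refine ⟨⟨fun d => f (d, false), fun d => fa (d, false), fun d h => ?_⟩⟩
  obtain ⟨e1, e2⟩ := h
  rcases ht d with h' | h' | h'
  · have k : b₀ (G.σ d, false) = (G.σ (G.σ d), false) := by
      simp only [b₀, hσ, h', c]
      rw [if_neg (n1 d).symm, if_neg (n2 d).symm]
    have := fb (G.σ d, false)
    rw [coe_fn_mk, k, ← e1, ← e2] at this
    simp at this
  · have k : b₀ (d, false) = (G.σ (G.σ d), false) := by
      simp only [b₀, h']
      rw [if_neg (n1 d), if_pos trivial]
    have := fb (d, false)
    rw [coe_fn_mk, k, ← e2] at this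
    simp at this
  · have k : b₀ (d, false) = (G.σ d, false) := by
      simp only [b₀, h']
      rw [if_neg (n2 d), if_neg (n1 _)]
    have := fb (d, false)
    rw [coe_fn_mk, k, ← e1] at this
    simp at this

section PlaquetteOp

variable {G} {N : ℕ} {M : StringNetModel N}

/-- The matrix entry of `B_p^i` from `ℓ` to `ℓ'`.

A counterclockwise loop of type `i` in `p` is fused into the edges around `p`. Every T-junction
(corner of `p`), with inward labels `c` on the incoming, `b` on the outgoing boundary edge
and `a` on the third edge, contributes the factor `F^{abc}_{i* c' b'}`, where `b`, `c` change
into `b'`, `c'`.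

Every edge changes its label in two stages, from `ℓ` via `μ` to `ℓ'`, one for each side, in the
order given by `o`; a stage is trivial if the plaquette on this side is not `p`. The corners at a
vertex are thus processed one after the other, each with the labels that it finds. If all edges of
`p` have another plaquette on their other side and no vertex occurs twice on the boundary, then the
entry is the usual product of `F^{a b c}_{i* c' b'}` over the corners, where `a`, `b`, `c` are labels
of `ℓ`, and `b'`, `c'` are labels of `ℓ'`. -/
def plaquetteEntry [Fintype D] (o : G.FusionOrder) (p : G.Plaquette) (i : Fin (N + 1))
    (ℓ' ℓ : G.Labeling M) : ℂ :=
  open Classical in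
  ∑ μ : G.Labeling M,
    if ∀ x, o.first x = true →
        (G.face x ≠ p → μ x = ℓ x) ∧ (G.face (G.α x) ≠ p → ℓ' x = μ x) then
      ∏ x : D, if G.face x = p then
          M.F
            (if o.first x then (if o.first (G.σ x) then μ (G.σ (G.σ x)) else ℓ (G.σ (G.σ x)))
              else (if o.first (G.σ x) then ℓ' (G.σ (G.σ x)) else μ (G.σ (G.σ x))))
            (if o.first x then ℓ x else μ x)
            (if o.first (G.σ x) then μ (G.σ x) else ℓ (G.σ x))
            (M.star i)
            (if o.first (G.σ x) then ℓ' (G.σ x) else μ (G.σ x))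
            (if o.first x then μ x else ℓ' x)
        else 1
    else 0

/-- The operator `B_p^i` that adds a counterclockwise loop of type `i` in the plaquette `p`. -/
def loopOp [Fintype D] (M : StringNetModel N) (o : G.FusionOrder) (p : G.Plaquette)
    (i : Fin (N + 1)) : G.Hilbert M →ₗ[ℂ] G.Hilbert M :=
  Matrix.toEuclideanLin (Matrix.of (plaquetteEntry (M := M) o p i))

/-- The plaquette operator `B_p = (∑ i, d_i B_p^i) / ∑ i, d_i²`. -/
def plaquetteOp [Fintype D] (M : StringNetModel N) (o : G.FusionOrder) (p : G.Plaquette) :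
    G.Hilbert M →ₗ[ℂ] G.Hilbert M :=
  (∑ i, M.d i ^ 2)⁻¹ • ∑ i, M.d i • loopOp M o p i

end PlaquetteOp

end TrivalentMap
end

noncomputable section

namespace StringNetModel

variable {N : ℕ} (M : StringNetModel N)

/-! ### The tetrahedrally symmetric tensor -/

/-! The coefficients of `plaquetteOp` do not depend on the graph, so it suffices that an F-move
intertwines each `loopOp` separately. Dividing `F` by square roots of absolute values of dimensions
gives a tensor `symF` with exact tetrahedral symmetry, for which the pentagon identity has the
weight |d_n| in its sum. All local identities below are instances of this pentagon.

Near the reconnected edge there are four corners of plaquettes to consider. A plaquette beside the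
edge has two corners there before the move and one after it (`fmove_corner_side`); a plaquette
facing an end of the edge has one before and two after (`fmove_corner_end`); the remaining two cases
follow by a half turn. `fmove_corners` chains the four identities. Whether each of the four
plaquettes carries the loop is a separate proposition, so some or all of them may coincide, provided
that the loops beside the edge are fused first.

The difficulty is that the orders `o` and `o'` are arbitrary, and reversing the order at one edge
affects both of its ends, where it may create a cyclic order. Therefore `orderedEntry` lets the two
ends of an edge have independent orders and inserts the change of basis `transition` where they
disagree. By the pentagon again, interchanging two consecutive corners at one vertex is absorbed by
this matrix (`sum_corners_exchange`). Such interchanges connect all linear orders at a vertex, so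
the entry is the same for all of them (`orderedEntry_eq_of_acyclic`). The orders at the two ends of
the edge can then be chosen to fit `fmove_corners`, while everything else agrees in the two graphs
(`orderedEntry_fmove`). -/

theorem d_ne_zero (i : Fin (N + 1)) : M.d i ≠ 0 := inv_ne_zero (M.F_ne_zero i)

theorem d_star (i : Fin (N + 1)) : M.d (M.star i) = M.d i := by
  have h := M.tetrahedral₁ (M.star i) i (M.star i) i 0 0
  rw [M.star_zero] at h
  rw [StringData.d, StringData.d, M.star_star, h]

/-- Unitarity turns conjugation into duality, under which dimensions are invariant. Thus dimensions
are real, but they may be negative. -/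
theorem conj_d (i : Fin (N + 1)) : (starRingEnd ℂ) (M.d i) = M.d i := by
  conv_rhs => rw [← d_star]
  rw [StringData.d, StringData.d, map_inv₀, M.unitarity, M.star_zero]

/-- The square root of the absolute value of the quantum dimension. -/
def rootDim (i : Fin (N + 1)) : ℂ := (Real.sqrt ‖M.d i‖ : ℂ)

theorem rootDim_ne_zero (i : Fin (N + 1)) : M.rootDim i ≠ 0 := by
  have := norm_pos_iff.2 (M.d_ne_zero i)
  rw [rootDim, Complex.ofReal_ne_zero]
  positivity

@[simp] theorem rootDim_star (i : Fin (N + 1)) : M.rootDim (M.star i) = M.rootDim i := by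
  rw [rootDim, rootDim, d_star]

theorem sqrt_real_neg {q : ℝ} (hq : q < 0) :
    (q : ℂ) ^ (1 / 2 : ℂ) = (Real.sqrt (-q) : ℂ) * Complex.I := by
  rw [Complex.ofReal_cpow_of_nonpos hq.le, Real.sqrt_eq_rpow, Complex.ofReal_cpow (by linarith)]
  congr 1
  · push_cast; rfl
  · rw [show (Real.pi : ℂ) * Complex.I * (1 / 2) = Real.pi / 2 * Complex.I by ring,
      Complex.exp_pi_div_two_mul_I]

/-- Both principal roots are positive multiples of `Complex.I`. The resulting sign forces certain
components of `F` to vanish in `F_swap_middle`. -/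
theorem sqrt_mul_sqrt_inv_of_neg {q : ℝ} (hq : q < 0) :
    (q : ℂ) ^ (1 / 2 : ℂ) * ((q⁻¹ : ℝ) : ℂ) ^ (1 / 2 : ℂ) = -1 := by
  have h1 : Real.sqrt (-q) * Real.sqrt (-q⁻¹) = 1 := by
    rw [← Real.sqrt_mul (by linarith), neg_mul_neg, mul_inv_cancel₀ hq.ne, Real.sqrt_one]
  rw [sqrt_real_neg hq, sqrt_real_neg (inv_lt_zero.2 hq), mul_mul_mul_comm, Complex.I_mul_I,
    ← Complex.ofReal_mul, h1]
  simp

/-- Let q be the quotient of dimensions in `tetrahedral₃`. Applying that symmetry twice multiplies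
`F` by √q √(q⁻¹). For q < 0 this is -1, so `F` vanishes and any factor will do; for q > 0 the root
of q is the quotient of the roots of the absolute values. -/
theorem F_swap_middle (i j k l m n : Fin (N + 1)) :
    M.F i j m k l n = M.F i m j (M.star k) n l *
      (M.rootDim m * M.rootDim n / (M.rootDim j * M.rootDim l)) := by
  have hx : ∀ i, ∃ x : ℝ, x ≠ 0 ∧ M.d i = x ∧ M.rootDim i = (Real.sqrt |x| : ℂ) := fun i => by
    obtain ⟨x, hx⟩ := Complex.conj_eq_iff_real.1 (M.conj_d i)
    refine ⟨x, ?_, hx, ?_⟩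
    · have := M.d_ne_zero i
      rw [hx] at this
      exact_mod_cast this
    · rw [rootDim, hx, Complex.norm_real, Real.norm_eq_abs]
  obtain ⟨a, ha, ha', ra⟩ := hx m
  obtain ⟨b, hb, hb', rb⟩ := hx n
  obtain ⟨c, hc, hc', rc⟩ := hx j
  obtain ⟨e, he, he', re⟩ := hx l
  have h1 := M.tetrahedral₃ i j k l m n
  have h2 := M.tetrahedral₃ i m (M.star k) n j l
  rw [M.star_star] at h2
  rw [ha', hb', hc', he'] at h1 h2
  have e1 : (a * b / (c * e) : ℂ) = ((a * b / (c * e) : ℝ) : ℂ) := by push_cast; rfl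
  have e2 : (c * e / (a * b) : ℂ) = (((a * b / (c * e))⁻¹ : ℝ) : ℂ) := by
    rw [inv_div]; push_cast; rfl
  rw [e1] at h1
  rw [e2] at h2
  have hq : a * b / (c * e) ≠ 0 := by positivity
  rcases lt_or_gt_of_ne hq with hq | hq
  · have h3 := sqrt_mul_sqrt_inv_of_neg hq
    have h4 : M.F i m j (M.star k) n l = 0 := by
      have : M.F i m j (M.star k) n l = - M.F i m j (M.star k) n l := by
        conv_lhs => rw [h2, h1, mul_assoc, h3]
        ring
      exact self_eq_neg.1 this
    rw [h1, h4]; ring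
  · rw [h1, ra, rb, rc, re, ← Complex.ofReal_mul, ← Complex.ofReal_mul, ← Complex.ofReal_div,
      ← Real.sqrt_mul (abs_nonneg _), ← Real.sqrt_mul (abs_nonneg _), ← abs_mul, ← abs_mul,
      ← Real.sqrt_div (abs_nonneg _), ← abs_div, abs_of_pos hq, Real.sqrt_eq_rpow,
      Complex.ofReal_cpow hq.le]
    push_cast
    rfl

/-- The tensor `F` in the gauge in which it has the symmetries of a tetrahedron. -/
def symF (i j m k l n : Fin (N + 1)) : ℂ := M.F i j m k l n / (M.rootDim m * M.rootDim n)

theorem F_eq (i j m k l n : Fin (N + 1)) :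
    M.F i j m k l n = M.rootDim m * M.rootDim n * M.symF i j m k l n := by
  rw [symF, mul_div_cancel₀]
  exact mul_ne_zero (M.rootDim_ne_zero m) (M.rootDim_ne_zero n)

theorem symF_tet₁ (i j m k l n : Fin (N + 1)) :
    M.symF i j m k l n = M.symF j i m l k (M.star n) := by
  rw [symF, symF, M.tetrahedral₁, rootDim_star]

theorem symF_tet₂ (i j m k l n : Fin (N + 1)) :
    M.symF i j m k l n = M.symF l k (M.star m) j i n := by
  rw [symF, symF, M.tetrahedral₂, rootDim_star]

theorem symF_tet₃ (i j m k l n : Fin (N + 1)) :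
    M.symF i j m k l n = M.symF i m j (M.star k) n l := by
  rw [symF, symF, M.F_swap_middle]
  have := M.rootDim_ne_zero m
  have := M.rootDim_ne_zero n
  have := M.rootDim_ne_zero j
  have := M.rootDim_ne_zero l
  field_simp

/-- The roots for p, q, r, s occur once on each side and cancel; the summation label n sits in two
of the tensors and leaves its square. -/
theorem symF_pentagon (i j k l m p q r s : Fin (N + 1)) :
    ∑ n, M.rootDim n ^ 2 * (M.symF m l q k p n * M.symF j i (M.star p) m n s *
      M.symF j s n l k r) =
      M.symF j i (M.star p) (M.star q) k r * M.symF (M.star r) i (M.star q) m l s := by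
  have h := M.pentagon i j k l m p q r s
  simp only [F_eq, rootDim_star] at h
  have c : M.rootDim p * M.rootDim q * M.rootDim r * M.rootDim s ≠ 0 := by
    simp [rootDim_ne_zero]
  apply mul_left_cancel₀ c
  rw [Finset.mul_sum]
  refine Eq.trans (Finset.sum_congr rfl fun n _ => ?_) (h.trans ?_)
  · ring
  · ring

/-! ### Corner factors -/

theorem star_eq_iff {i j : Fin (N + 1)} : M.star i = j ↔ i = M.star j :=
  ⟨fun h => by rw [← h, M.star_star], fun h => by rw [h, M.star_star]⟩

theorem star_inj {i j : Fin (N + 1)} : M.star i = M.star j ↔ i = j := by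
  rw [star_eq_iff, M.star_star]

/-- Duality as a permutation of the string types. -/
def starEquiv : Perm (Fin (N + 1)) := ⟨M.star, M.star, M.star_star, M.star_star⟩

@[simp] theorem starEquiv_apply (i : Fin (N + 1)) : M.starEquiv i = M.star i := rfl

open Classical in
/-- The factor of a corner, for a loop of type `s` in the plaquette of the corner if `P` holds and
without a loop otherwise. -/
def corner (s : Fin (N + 1)) (P : Prop) (a b c c' b' : Fin (N + 1)) : ℂ :=
  if P then M.F a b c (M.star s) c' b' else if b = b' ∧ c = c' then 1 else 0

theorem corner_true {s : Fin (N + 1)} {P : Prop} (h : P) (a b c c' b' : Fin (N + 1)) :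
    M.corner s P a b c c' b' = M.rootDim c * M.rootDim b' * M.symF a b c (M.star s) c' b' := by
  rw [corner, if_pos h, F_eq]

theorem corner_false {s : Fin (N + 1)} {P : Prop} (h : ¬ P) (a b c c' b' : Fin (N + 1)) :
    M.corner s P a b c c' b' = if b = b' ∧ c = c' then 1 else 0 := by
  rw [corner, if_neg h]

/-! ### Corners at the reconnected edge -/

theorem sum_comm_pairs {ι R : Type*} [Fintype ι] [AddCommMonoid R] (f : ι → ι → ι → ι → R) :
    ∑ a, ∑ b, ∑ c, ∑ d, f a b c d = ∑ c, ∑ d, ∑ b, ∑ a, f a b c d :=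
  Finset.sum_comm.trans <| (Finset.sum_congr rfl fun _ _ => Finset.sum_comm).trans <|
    Finset.sum_comm.trans <| Finset.sum_congr rfl fun _ _ =>
      (Finset.sum_congr rfl fun _ _ => Finset.sum_comm).trans Finset.sum_comm

/-- For a plaquette beside the edge the pentagon merges its two corners into one. Without a loop,
both sides reduce to Kronecker deltas times `F`. -/
theorem fmove_corner_side (s : Fin (N + 1)) (P : Prop) (i i' j k l l' m n : Fin (N + 1)) :
    ∑ m', M.corner s P j m i i' m' * M.corner s P k l (M.star m) (M.star m') l' *
      M.F i' j m' k l' n = M.F i j m k l n * M.corner s P n l i i' l' := by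
  by_cases h : P
  · simp only [M.corner_true h, F_eq, rootDim_star]
    have h1 : M.symF i j m k l n = M.symF j i m l k (M.star n) :=
      M.symF_tet₁ _ _ _ _ _ _
    have h2 : M.symF n l i (M.star s) i' l' = M.symF n i l s l' i' :=
      (M.symF_tet₃ _ _ _ _ _ _).trans <| by simp only [M.star_star]
    have h3 : ∀ m', M.symF k l (M.star m) (M.star s) (M.star m') l' =
        M.symF s l' (M.star l) k (M.star m) m' := fun m' =>
      (M.symF_tet₃ _ _ _ _ _ _).trans <| (M.symF_tet₁ _ _ _ _ _ _).trans <|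
        (M.symF_tet₂ _ _ _ _ _ _).trans <| by simp only [M.star_star]
    have h4 : ∀ m', M.symF j m i (M.star s) i' m' = M.symF j i m s m' i' := fun m' =>
      (M.symF_tet₃ _ _ _ _ _ _).trans <| by simp only [M.star_star]
    have h5 : ∀ m', M.symF i' j m' k l' n = M.symF j i' m' l' k (M.star n) := fun m' =>
      M.symF_tet₁ _ _ _ _ _ _
    have hp := M.symF_pentagon i j k l' s (M.star m) (M.star l) (M.star n) i'
    simp only [M.star_star] at hp
    simp only [h1, h2, h3, h4, h5]
    rw [show ∀ a b c d x y : ℂ, a * b * x * (c * d * y) = a * b * c * d * (x * y) by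
      intros; ring, ← hp, Finset.mul_sum]
    exact Finset.sum_congr rfl fun m' _ => by ring
  · simp only [M.corner_false h, M.star_inj]
    rw [Finset.sum_eq_single m]
    · by_cases h1 : i = i' <;> by_cases h2 : l = l' <;> simp [h1, h2]
    · intro m' _ hm
      simp [hm.symm]
    · simp

/-- For a plaquette facing an end of the edge the pentagon is read in the opposite direction: one
corner splits into two. -/
theorem fmove_corner_end (s : Fin (N + 1)) (P : Prop) (i i' j j' k l m n' : Fin (N + 1)) :
    M.corner s P m i j j' i' * M.F i' j' m k l n' =
      ∑ n, M.F i j m k l n * M.corner s P l i n n' i' *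
        M.corner s P k (M.star n) j j' (M.star n') := by
  by_cases h : P
  · simp only [M.corner_true h, F_eq, rootDim_star]
    have h1 : M.symF m i j (M.star s) j' i' = M.symF i m j j' (M.star s) (M.star i') :=
      M.symF_tet₁ _ _ _ _ _ _
    have h2 : M.symF i' j' m k l n' = M.symF i' m j' (M.star k) n' l :=
      M.symF_tet₃ _ _ _ _ _ _
    have h3 : ∀ n, M.symF k (M.star n) j (M.star s) j' (M.star n') =
        M.symF (M.star k) n' (M.star j') (M.star s) (M.star j) n := fun n =>
      (M.symF_tet₁ _ _ _ _ _ _).trans <| (M.symF_tet₂ _ _ _ _ _ _).trans <|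
        (M.symF_tet₃ _ _ _ _ _ _).trans <| (M.symF_tet₁ _ _ _ _ _ _).trans <|
          (M.symF_tet₂ _ _ _ _ _ _).trans <| by simp only [M.star_star]
    have h4 : ∀ n, M.symF i j m k l n = M.symF i m j (M.star k) n l := fun n =>
      M.symF_tet₃ _ _ _ _ _ _
    have h5 : ∀ n, M.symF l i n (M.star s) n' i' = M.symF i l n n' (M.star s) (M.star i') :=
      fun n => M.symF_tet₁ _ _ _ _ _ _
    have hp := M.symF_pentagon m i (M.star s) n' (M.star k) (M.star j) (M.star j') (M.star i') l
    simp only [M.star_star] at hp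
    simp only [h1, h2, h3, h5]
    simp only [h4]
    rw [show ∀ a b c d x y : ℂ, a * b * x * (c * d * y) = a * b * c * d * (x * y) by
      intros; ring, ← hp, Finset.mul_sum]
    exact Finset.sum_congr rfl fun m' _ => by ring
  · simp only [M.corner_false h, M.star_inj]
    rw [Finset.sum_eq_single n']
    · by_cases h1 : i = i' <;> by_cases h2 : j = j' <;> simp [h1, h2]
    · intro n _ hn
      simp [hn]
    · simp

/-- Invariance under the half turn that exchanges the two ends of the edge. It reduces the other two
plaquettes around the edge to the cases already treated, with the summation label dualized. -/
theorem F_rotate (i j k l m n : Fin (N + 1)) :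
    M.F k l (M.star m) i j (M.star n) = M.F i j m k l n := by
  rw [M.tetrahedral₁ i, M.tetrahedral₂ j]

theorem fmove_corner_side' (s : Fin (N + 1)) (P : Prop) (i j j' k k' l m n : Fin (N + 1)) :
    ∑ m', M.corner s P i j m m' j' * M.corner s P l (M.star m) k k' (M.star m') *
      M.F i j' m' k' l n =
    M.F i j m k l n * M.corner s P (M.star n) j k k' j' := by
  have h := M.fmove_corner_side s P k k' l i j j' (M.star m) (M.star n)
  rw [M.F_rotate, M.star_star, ← Equiv.sum_comp M.starEquiv] at h
  rw [← h]
  refine Finset.sum_congr rfl fun m' _ => ?_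
  rw [starEquiv_apply, M.F_rotate, M.star_star]
  ring

theorem fmove_corner_end' (s : Fin (N + 1)) (P : Prop) (i j k k' l l' m n' : Fin (N + 1)) :
    M.corner s P (M.star m) k l l' k' * M.F i j m k' l' n' =
      ∑ n, M.F i j m k l n * M.corner s P i n l l' n' *
        M.corner s P j k (M.star n) (M.star n') k' := by
  have h := M.fmove_corner_end s P k k' l l' i j (M.star m) (M.star n')
  rw [M.F_rotate, M.star_star, ← Equiv.sum_comp M.starEquiv] at h
  rw [h]
  refine Finset.sum_congr rfl fun n _ => ?_
  rw [starEquiv_apply, M.F_rotate, M.star_star]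
  ring

/-- An F-move commutes with loops in the four plaquettes around the reconnected edge, of which the
loops on the two sides of the edge are fused first. -/
theorem fmove_corners (s : Fin (N + 1)) (PL PR PT PB : Prop)
    (i j k l i' j' k' l' i'' j'' k'' l'' m n : Fin (N + 1)) :
    ∑ m', ∑ u, M.F i'' j'' m' k'' l'' n *
      ((M.corner s PL j m i i' u * M.corner s PT m' i' j' j'' i'' *
        M.corner s PR i' j u m' j') *
      (M.corner s PR l' (M.star u) k k' (M.star m') *
        M.corner s PB (M.star m') k' l' l'' k'' * M.corner s PL k l (M.star m) (M.star u) l')) =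
    ∑ m', ∑ u, M.F i j m k l m' *
      ((M.corner s PB i'' u l' l'' n * M.corner s PT l' i' m' u i'' *
        M.corner s PL m' l i i' l') *
      (M.corner s PT k' (M.star m') j' j'' (M.star u) *
        M.corner s PB j'' k' (M.star u) (M.star n) k'' *
        M.corner s PR (M.star m') j k k' j')) := by
  -- The F-move is pulled through the loops one at a time, starting with the loop that is fused
  -- last.
  have eB := fun m' => M.fmove_corner_end' s PB i'' j'' k' k'' l' l'' m' n
  have eT := fun m' u => M.fmove_corner_end s PT i' i'' j' j'' k' l' m' u
  have eR := fun u m' => M.fmove_corner_side' s PR i' j j' k k' l' u m'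
  have eL := fun m' => M.fmove_corner_side s PL i i' j k l l' m m'
  calc
    _ = ∑ m', ∑ u, M.corner s PL j m i i' u * M.corner s PL k l (M.star m) (M.star u) l' *
          (M.corner s PR i' j u m' j' * M.corner s PR l' (M.star u) k k' (M.star m') *
          (M.corner s PT m' i' j' j'' i'' *
          (M.corner s PB (M.star m') k' l' l'' k'' * M.F i'' j'' m' k'' l'' n))) :=
      Finset.sum_congr rfl fun m' _ => Finset.sum_congr rfl fun u _ => by ring
    _ = ∑ m', ∑ u, M.corner s PL j m i i' u * M.corner s PL k l (M.star m) (M.star u) l' *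
          (M.corner s PR i' j u m' j' * M.corner s PR l' (M.star u) k k' (M.star m') *
          ∑ t, (∑ r, M.F i' j' m' k' l' r * M.corner s PT l' i' r t i'' *
            M.corner s PT k' (M.star r) j' j'' (M.star t)) *
            (M.corner s PB i'' t l' l'' n * M.corner s PB j'' k' (M.star t) (M.star n) k'')) := by
      refine Finset.sum_congr rfl fun m' _ => Finset.sum_congr rfl fun u _ => ?_
      rw [eB, Finset.mul_sum]
      simp only [← eT]
      congr 2
      exact Finset.sum_congr rfl fun t _ => by ring
    _ = ∑ t, ∑ r, (∑ u, M.corner s PL j m i i' u * M.corner s PL k l (M.star m) (M.star u) l' *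
          ∑ m', M.corner s PR i' j u m' j' * M.corner s PR l' (M.star u) k k' (M.star m') *
            M.F i' j' m' k' l' r) * (M.corner s PT l' i' r t i'' *
            M.corner s PT k' (M.star r) j' j'' (M.star t) *
            (M.corner s PB i'' t l' l'' n *
              M.corner s PB j'' k' (M.star t) (M.star n) k'')) := by
      simp only [Finset.mul_sum, Finset.sum_mul]
      rw [sum_comm_pairs]
      refine Finset.sum_congr rfl fun t _ => Finset.sum_congr rfl fun r _ =>
        Finset.sum_congr rfl fun u _ => Finset.sum_congr rfl fun m' _ => ?_
      ring
    _ = _ := by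
      simp only [eR]
      rw [Finset.sum_comm]
      refine Finset.sum_congr rfl fun r _ => Finset.sum_congr rfl fun t _ => ?_
      simp only [← mul_assoc]
      simp only [← Finset.sum_mul]
      rw [eL]
      ring

/-! ### Exchanging the order of two loops at an edge -/

open Classical in
/-- The change of basis between the two orders of fusing loops of type `s` into an edge from
its two sides, where `P`, `Q` tell on which sides there is a loop, and `b`, `b'` are the labels of
the edge before and after. The two ends of the edge have orders `α`, `β`, and `u`, `w` are the
intermediate labels at the two ends, both directed towards the respective end. -/
def transition (s : Fin (N + 1)) (P Q : Prop) (α β : Bool) (b b' u w : Fin (N + 1)) : ℂ :=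
  if α ≠ β then (if w = M.star u then 1 else 0)
  else if α then
    if P ∧ Q then
      M.rootDim b * M.rootDim b' * M.symF s b' w (M.star s) (M.star b) u
    else if (P ∨ u = b ∧ w = M.star b') ∧ (Q ∨ u = b' ∧ w = M.star b) then 1 else 0
  else
    if P ∧ Q then
      M.rootDim u ^ 2 * M.rootDim w ^ 2 / (M.rootDim b * M.rootDim b') *
        M.symF s b (M.star u) (M.star s) (M.star b') (M.star w)
    else if (P ∨ u = b' ∧ w = M.star b) ∧ (Q ∨ u = b ∧ w = M.star b') then 1 else 0

/-- The change of basis belongs to the unoriented edge: its two tensors are invariant under the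
tetrahedral symmetry that reverses the edge. So it may be evaluated at either dart. -/
theorem transition_symm (s : Fin (N + 1)) (P Q : Prop) (α β : Bool) (b b' u w : Fin (N + 1)) :
    M.transition s Q P β α (M.star b) (M.star b') w u = M.transition s P Q α β b b' u w := by
  have e : u = M.star w ↔ w = M.star u := by rw [eq_comm, star_eq_iff]
  have h1 : M.symF s b' w (M.star s) (M.star b) u =
      M.symF s (M.star b') u (M.star s) b w :=
    (M.symF_tet₃ _ _ _ _ _ _).trans <| (M.symF_tet₁ _ _ _ _ _ _).trans <|
      (M.symF_tet₂ _ _ _ _ _ _).trans <| (M.symF_tet₃ _ _ _ _ _ _).trans <| by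
        simp only [M.star_star]
  have h2 : M.symF s b (M.star u) (M.star s) (M.star b') (M.star w) =
      M.symF s (M.star b) (M.star w) (M.star s) b' (M.star u) :=
    (M.symF_tet₃ _ _ _ _ _ _).trans <| (M.symF_tet₁ _ _ _ _ _ _).trans <|
      (M.symF_tet₂ _ _ _ _ _ _).trans <| (M.symF_tet₃ _ _ _ _ _ _).trans <| by
        simp only [M.star_star]
  unfold transition
  simp only [h1, h2, M.star_star, e, rootDim_star, @and_comm Q P, ne_comm (a := β)]
  by_cases hab : α = β
  · subst hab
    cases α <;> by_cases hP : P <;> by_cases hQ : Q <;>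
      simp [hP, hQ, and_comm, and_left_comm, mul_comm, M.star_star]
  · simp [hab]

/-- The change of basis converts the order at this end into the order at the far end, whose
intermediate label is `w`. With loops on both sides this is a pentagon summed over `u`; the weight
|d_u| comes from the two corners, each of which contributes a root for `u`. -/
theorem sum_corners_transition_true (s : Fin (N + 1)) (P Q : Prop)
    (a a' b b' c c' w : Fin (N + 1)) :
    ∑ u, M.corner s P a b c c' u * M.corner s Q c' a u b' a' *
      M.transition s P Q true true b b' u w =
    M.corner s Q c a b (M.star w) a' * M.corner s P a' (M.star w) c c' b' := by
  have e : b = M.star w ↔ w = M.star b := by rw [eq_comm, star_eq_iff]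
  have e' : M.star w = b' ↔ w = M.star b' := M.star_eq_iff
  by_cases hP : P <;> by_cases hQ : Q
  · simp only [M.corner_true hP, M.corner_true hQ]
    simp only [transition, hP, hQ, ne_eq, not_true, if_false, if_true, and_self]
    have h1 : ∀ w, M.symF c a b (M.star s) w a' = M.symF a c b w (M.star s) (M.star a') := fun w =>
      M.symF_tet₁ _ _ _ _ _ _
    have h2 : ∀ w, M.symF a' w c (M.star s) c' b' = M.symF a' c w s b' c' := fun w =>
      (M.symF_tet₃ _ _ _ _ _ _).trans <| by simp only [M.star_star]
    have h4 : ∀ u, M.symF a b c (M.star s) c' u = M.symF a c b s u c' := fun u =>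
      (M.symF_tet₃ _ _ _ _ _ _).trans <| by simp only [M.star_star]
    have h5 : ∀ u, M.symF c' a u (M.star s) b' a' = M.symF a c' u b' (M.star s) (M.star a') :=
      fun u => M.symF_tet₁ _ _ _ _ _ _
    have hp := M.symF_pentagon c a (M.star s) b' s (M.star b) w (M.star a') c'
    simp only [M.star_star] at hp
    simp only [h1, h2, h4, h5]
    rw [show ∀ a b c d x y : ℂ, a * b * x * (c * d * y) = a * b * c * d * (x * y) by
      intros; ring, ← hp, Finset.mul_sum]
    exact Finset.sum_congr rfl fun m' _ => by ring
  · simp only [M.corner_false hQ]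
    rw [Finset.sum_eq_single b']
    · by_cases ha : a = a' <;> by_cases hw : w = M.star b <;>
        simp [transition, hP, hQ, ha, hw, e, M.star_star]
    · intro u _ hu
      simp [hu]
    · simp
  · simp only [M.corner_false hP]
    rw [Finset.sum_eq_single b]
    · by_cases hc : c = c' <;> by_cases hw : w = M.star b' <;>
        simp [transition, hP, hQ, hc, hw, e', M.star_star]
    · intro u _ hu
      simp [hu.symm]
    · simp
  · simp only [M.corner_false hP, M.corner_false hQ]
    rw [Finset.sum_eq_single b]
    · by_cases ha : a = a' <;> by_cases hc : c = c' <;> by_cases hb : b = b' <;>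
        by_cases hw : w = M.star b' <;>
        simp [transition, hP, hQ, ha, hb, hc, hw, e', M.star_star]
    · intro u _ hu
      simp [hu.symm]
    · simp

/-- The opposite conversion. Here the corners contribute no root for `u`, which is why this branch
of `transition` carries the weight itself, together with the roots for `w`, `b` and `b'` that
balance the corner factors. -/
theorem sum_corners_transition_false (s : Fin (N + 1)) (P Q : Prop)
    (a a' b b' c c' w : Fin (N + 1)) :
    ∑ u, M.corner s Q c a b u a' * M.corner s P a' u c c' b' *
      M.transition s P Q false false b b' u w =
    M.corner s P a b c c' (M.star w) * M.corner s Q c' a (M.star w) b' a' := by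
  have e : b = M.star w ↔ w = M.star b := by rw [eq_comm, star_eq_iff]
  have e' : M.star w = b' ↔ w = M.star b' := M.star_eq_iff
  by_cases hP : P <;> by_cases hQ : Q
  · simp only [M.corner_true hP, M.corner_true hQ]
    simp only [transition, hP, hQ, ne_eq, not_true, if_false, and_self, Bool.false_eq_true,
      if_true]
    have h1 : ∀ u, M.symF a b c (M.star s) c' u =
        M.symF (M.star s) c' (M.star c) a b (M.star u) := fun u =>
      (M.symF_tet₁ _ _ _ _ _ _).trans (M.symF_tet₂ _ _ _ _ _ _)
    have h2 : ∀ u, M.symF c' a u (M.star s) b' a' = M.symF u c' a a' s (M.star b') := fun u =>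
      (M.symF_tet₃ _ _ _ _ _ _).trans <| (M.symF_tet₁ _ _ _ _ _ _).trans <| by
        simp only [M.star_star]
    have h3 : ∀ w, M.symF c a b (M.star s) w a' = M.symF a' s (M.star a) b c w := fun w =>
      (M.symF_tet₃ _ _ _ _ _ _).trans <| (M.symF_tet₂ _ _ _ _ _ _).trans <| by
        simp only [M.star_star]
    have h4 : ∀ w, M.symF a' w c (M.star s) c' b' =
        M.symF (M.star s) c' (M.star c) a' w (M.star b') := fun w =>
      (M.symF_tet₁ _ _ _ _ _ _).trans (M.symF_tet₂ _ _ _ _ _ _)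
    have h5 : ∀ w u, M.symF s b (M.star w) (M.star s) (M.star b') u =
        M.symF (M.star s) (M.star b') w s b (M.star u) := fun w u =>
      (M.symF_tet₁ _ _ _ _ _ _).trans <| (M.symF_tet₂ _ _ _ _ _ _).trans <| by
        simp only [M.star_star]
    have hp := M.symF_pentagon c' (M.star s) b s a' c (M.star a) w (M.star b')
    simp only [M.star_star] at hp
    simp only [h1, h2, h3, h4, h5, M.star_star, rootDim_star]
    rw [show ∀ a b c d x y : ℂ, a * b * x * (c * d * y) = a * b * c * d * (x * y) by
      intros; ring, ← hp, Finset.mul_sum]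
    have := M.rootDim_ne_zero b
    have := M.rootDim_ne_zero b'
    exact Finset.sum_congr rfl fun m' _ => by field_simp
  · simp only [M.corner_false hQ]
    rw [Finset.sum_eq_single b]
    · by_cases ha : a = a' <;> by_cases hw : w = M.star b' <;>
        simp [transition, hP, hQ, ha, hw, e', M.star_star]
    · intro u _ hu
      simp [hu.symm]
    · simp
  · simp only [M.corner_false hP]
    rw [Finset.sum_eq_single b']
    · by_cases hc : c = c' <;> by_cases hw : w = M.star b <;>
        simp [transition, hP, hQ, hc, hw, e, M.star_star]
    · intro u _ hu
      simp [hu]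
    · simp
  · simp only [M.corner_false hP, M.corner_false hQ]
    rw [Finset.sum_eq_single b]
    · by_cases ha : a = a' <;> by_cases hc : c = c' <;> by_cases hb : b = b' <;>
        by_cases hw : w = M.star b' <;>
        simp [transition, hP, hQ, ha, hb, hc, hw, e', M.star_star]
    · intro u _ hu
      simp [hu.symm]
    · simp

/-- Whatever the order at the far end is, it agrees with exactly one of the two orders here. For
that one the transition is a Kronecker delta; the other one is converted by one of the two preceding
lemmas. -/
theorem sum_corners_exchange (s : Fin (N + 1)) (P Q : Prop) (β : Bool)
    (a a' b b' c c' w : Fin (N + 1)) :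
    ∑ u, M.corner s P a b c c' u * M.corner s Q c' a u b' a' *
      M.transition s P Q true β b b' u w =
    ∑ u, M.corner s Q c a b u a' * M.corner s P a' u c c' b' *
      M.transition s P Q false β b b' u w := by
  have h : ∀ (f : Fin (N + 1) → ℂ) (γ : Bool),
      ∑ u, f u * M.transition s P Q (!γ) γ b b' u w = f (M.star w) := by
    intro f γ
    rw [Finset.sum_eq_single (M.star w)]
    · simp [transition, M.star_star]
    · intro u _ hu
      have : w ≠ M.star u := fun h => hu (by rw [h, M.star_star])
      simp [transition, this]
    · simp
  cases β
  · rw [sum_corners_transition_false]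
    exact h _ false
  · rw [sum_corners_transition_true]
    exact (h (fun u => M.corner s Q c a b u a' * M.corner s P a' u c c' b') true).symm

end StringNetModel

namespace TrivalentMap

/-! ### Plaquette operators with independent orders at the vertices -/

/-- Resampling the value at `x` reaches every function once for each discarded value. This permits
sums over all intermediate labels to be compared after summation at a single dart. -/
theorem card_mul_sum {ι β : Type*} [Fintype ι] [DecidableEq ι] [Fintype β] (x : ι)
    (f : (ι → β) → ℂ) :
    (Fintype.card β : ℂ) * ∑ ν, f ν = ∑ ν, ∑ u, f (Function.update ν x u) := by
  let E := Equiv.funSplitAt x β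
  rw [← Equiv.sum_comp E.symm f,
    ← Equiv.sum_comp E.symm fun ν => ∑ u, f (Function.update ν x u), Fintype.sum_prod_type,
    Fintype.sum_prod_type]
  have h : ∀ v r u, Function.update (E.symm (v, r)) x u = E.symm (u, r) := by
    intro v r u
    ext j
    by_cases hj : j = x
    · subst hj; simp [E, Equiv.funSplitAt, Equiv.piSplitAt]
    · simp [E, Equiv.funSplitAt, Equiv.piSplitAt, hj]
  simp only [h]
  rw [Finset.sum_const, nsmul_eq_mul, Finset.card_univ, Finset.sum_comm]

theorem sum_eq_of_sum_update {ι β : Type*} [Fintype ι] [DecidableEq ι] [Fintype β] [Nonempty β]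
    (x : ι) {f g : (ι → β) → ℂ}
    (h : ∀ ν, ∑ u, f (Function.update ν x u) = ∑ u, g (Function.update ν x u)) :
    ∑ ν, f ν = ∑ ν, g ν := by
  have hc : (Fintype.card β : ℂ) ≠ 0 := by simp
  apply mul_left_cancel₀ hc
  simp only [card_mul_sum x, h]

variable {D : Type*} (G : TrivalentMap D) {N : ℕ} (M : StringNetModel N)

/-- The factor of the corner between `x` and `σ x`, if a label `ℓ d` changes into `ν d` and then
into `ℓ' d`, where the first of these two changes belongs to the left-hand side of `d` if and only
if `τ d` holds. -/
def cornerWeight (s : Fin (N + 1)) (P : D → Prop) (τ : D → Bool) (ℓ ν ℓ' : D → Fin (N + 1))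
    (x : D) : ℂ :=
  M.corner s (P x)
    (if τ x then (if τ (G.σ x) then ν (G.σ (G.σ x)) else ℓ (G.σ (G.σ x)))
      else (if τ (G.σ x) then ℓ' (G.σ (G.σ x)) else ν (G.σ (G.σ x))))
    (if τ x then ℓ x else ν x)
    (if τ (G.σ x) then ν (G.σ x) else ℓ (G.σ x))
    (if τ (G.σ x) then ℓ' (G.σ x) else ν (G.σ x))
    (if τ x then ν x else ℓ' x)

/-- The factor of the edge of `x`, counted at the dart `x` for which `ω x` holds. -/
def edgeWeight (s : Fin (N + 1)) (P : D → Prop) (ω τ : D → Bool) (ℓ ν ℓ' : D → Fin (N + 1))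
    (x : D) : ℂ :=
  if ω x then M.transition s (P x) (P (G.α x)) (τ x) (τ (G.α x)) (ℓ x) (ℓ' x) (ν x) (ν (G.α x))
  else 1

/-- A generalization of the matrix entries of the plaquette operators, in which the orders at the
two ends of an edge may differ. -/
def orderedEntry [Fintype D] [DecidableEq D] (s : Fin (N + 1)) (P : D → Prop) (ω τ : D → Bool)
    (ℓ' ℓ : D → Fin (N + 1)) : ℂ :=
  ∑ ν : D → Fin (N + 1), (∏ x, G.cornerWeight M s P τ ℓ ν ℓ' x) *
    ∏ x, G.edgeWeight M s P ω τ ℓ ν ℓ' x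

variable {G M}

theorem prod_vertex [Fintype D] [DecidableEq D] (f : D → ℂ) (x : D) :
    ∏ z, f z = f x * f (G.σ (G.σ x)) * f (G.σ x) *
      ∏ z ∈ ({x, G.σ (G.σ x), G.σ x} : Finset D)ᶜ, f z := by
  rw [← Finset.prod_mul_prod_compl {x, G.σ (G.σ x), G.σ x}, Finset.prod_insert,
    Finset.prod_pair (G.σ_ne _), ← mul_assoc]
  simp [(G.σ_ne x).symm, (G.sigma_sigma_ne x).symm]

theorem prod_edge [Fintype D] [DecidableEq D] (f : D → ℂ) (x : D) :
    ∏ z, f z = f x * f (G.α x) * ∏ z ∈ ({x, G.α x} : Finset D)ᶜ, f z := by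
  rw [← Finset.prod_mul_prod_compl {x, G.α x}, Finset.prod_pair (G.α_ne x).symm]

theorem edgeWeight_mul_alpha (s : Fin (N + 1)) (P : D → Prop) {ω : D → Bool}
    (hω : ∀ x, ω (G.α x) = !ω x) (τ : D → Bool) {ℓ ℓ' : D → Fin (N + 1)} (ν : D → Fin (N + 1))
    (x : D) (hℓ : ℓ (G.α x) = M.star (ℓ x)) (hℓ' : ℓ' (G.α x) = M.star (ℓ' x)) :
    G.edgeWeight M s P ω τ ℓ ν ℓ' x * G.edgeWeight M s P ω τ ℓ ν ℓ' (G.α x) =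
      M.transition s (P x) (P (G.α x)) (τ x) (τ (G.α x)) (ℓ x) (ℓ' x) (ν x) (ν (G.α x)) := by
  unfold edgeWeight
  rw [hω, G.α_α, hℓ, hℓ', M.transition_symm]
  cases ω x <;> simp

/-- The corners of `x` and `σ² x` lie on the two sides of the edge of `x`. The condition `hτ` says
that the third corner at the vertex comes first or last, so these two are consecutive, and
`sum_corners_exchange` applies to the sum over the label at `x`. -/
theorem orderedEntry_update_false [Fintype D] [DecidableEq D] (s : Fin (N + 1)) {P : D → Prop}
    (hP : ∀ x, P (G.σ (G.σ (G.α x))) ↔ P x) {ω : D → Bool} (hω : ∀ x, ω (G.α x) = !ω x)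
    {τ : D → Bool} (x : D) (hx : τ x = true) (hτ : τ (G.σ x) ≠ τ (G.σ (G.σ x)))
    {ℓ ℓ' : D → Fin (N + 1)} (hℓ : ∀ x, ℓ (G.α x) = M.star (ℓ x))
    (hℓ' : ∀ x, ℓ' (G.α x) = M.star (ℓ' x)) :
    G.orderedEntry M s P ω τ ℓ' ℓ = G.orderedEntry M s P ω (Function.update τ x false) ℓ' ℓ := by
  have n1 := G.σ_ne x
  have n2 := G.sigma_sigma_ne x
  have n3 := G.σ_ne (G.σ x)
  have n4 := G.α_ne x
  have c := G.σ_cubed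
  have hQ : P (G.σ (G.σ x)) = P (G.α x) := by
    have := hP (G.α x)
    rw [G.α_α] at this
    exact propext this
  refine sum_eq_of_sum_update x fun ν => ?_
  -- Coming first or last, the third corner sees only the initial or the final label at `x`, never
  -- the intermediate one.
  have e1 : ∀ τ : D → Bool, ∀ u, τ (G.σ x) ≠ τ (G.σ (G.σ x)) →
      G.cornerWeight M s P τ ℓ (Function.update ν x u) ℓ' (G.σ x) =
      M.corner s (P (G.σ x)) (if τ (G.σ x) then ℓ x else ℓ' x)
        (if τ (G.σ x) then ℓ (G.σ x) else ν (G.σ x))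
        (if τ (G.σ (G.σ x)) then ν (G.σ (G.σ x)) else ℓ (G.σ (G.σ x)))
        (if τ (G.σ (G.σ x)) then ℓ' (G.σ (G.σ x)) else ν (G.σ (G.σ x)))
        (if τ (G.σ x) then ν (G.σ x) else ℓ' (G.σ x)) := by
    intro τ u h
    unfold cornerWeight
    simp only [c, Function.update_of_ne n1, Function.update_of_ne n2]
    congr 1
    revert h
    cases τ (G.σ x) <;> cases τ (G.σ (G.σ x)) <;> simp
  have e2 : ∀ u, ∀ z ∈ ({x, G.σ (G.σ x), G.σ x} : Finset D)ᶜ,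
      G.cornerWeight M s P (Function.update τ x false) ℓ (Function.update ν x u) ℓ' z =
      G.cornerWeight M s P τ ℓ ν ℓ' z ∧
      G.cornerWeight M s P τ ℓ (Function.update ν x u) ℓ' z =
      G.cornerWeight M s P τ ℓ ν ℓ' z := by
    intro u z hz
    simp only [Finset.mem_compl, Finset.mem_insert, Finset.mem_singleton, not_or] at hz
    have m1 : G.σ z ≠ x := fun h => hz.2.1 (by rw [← h, c])
    have m2 : G.σ (G.σ z) ≠ x := fun h => hz.2.2 (by rw [← h, c])
    unfold cornerWeight
    simp only [Function.update_of_ne m1, Function.update_of_ne m2, Function.update_of_ne hz.1,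
      and_self]
  have e3 : ∀ u, ∀ z ∈ ({x, G.α x} : Finset D)ᶜ,
      G.edgeWeight M s P ω (Function.update τ x false) ℓ (Function.update ν x u) ℓ' z =
      G.edgeWeight M s P ω τ ℓ ν ℓ' z ∧
      G.edgeWeight M s P ω τ ℓ (Function.update ν x u) ℓ' z =
      G.edgeWeight M s P ω τ ℓ ν ℓ' z := by
    intro u z hz
    simp only [Finset.mem_compl, Finset.mem_insert, Finset.mem_singleton, not_or] at hz
    have m1 : G.α z ≠ x := fun h => hz.2 (by rw [← h, G.α_α])
    unfold edgeWeight
    simp only [Function.update_of_ne m1, Function.update_of_ne hz.1, and_self]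
  have hτ' : Function.update τ x false (G.σ x) ≠ Function.update τ x false (G.σ (G.σ x)) := by
    rwa [Function.update_of_ne n1, Function.update_of_ne n2]
  have k1 := fun τ u => prod_vertex (G := G) (G.cornerWeight M s P τ ℓ (Function.update ν x u) ℓ') x
  have k2 := fun τ u =>
    prod_edge (G := G) (G.edgeWeight M s P ω τ ℓ (Function.update ν x u) ℓ') x
  simp only [k1, k2, edgeWeight_mul_alpha s P hω _ _ x (hℓ x) (hℓ' x), e1 _ _ hτ, e1 _ _ hτ']
  simp only [fun u => Finset.prod_congr rfl fun z hz => (e2 u z hz).1,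
    fun u => Finset.prod_congr rfl fun z hz => (e2 u z hz).2,
    fun u => Finset.prod_congr rfl fun z hz => (e3 u z hz).1,
    fun u => Finset.prod_congr rfl fun z hz => (e3 u z hz).2]
  simp only [cornerWeight, c, Function.update_of_ne n1, Function.update_of_ne n2,
    Function.update_of_ne n4, Function.update_self, hx, hQ, if_true, Bool.false_eq_true, if_false]
  generalize (∏ z ∈ ({x, G.σ (G.σ x), G.σ x} : Finset D)ᶜ, _ : ℂ) = R
  generalize (∏ z ∈ ({x, G.α x} : Finset D)ᶜ, _ : ℂ) = R'
  generalize ht : τ (G.σ x) = t at *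
  generalize M.corner s (P (G.σ x)) _ _ _ _ _ = C
  have ht' : τ (G.σ (G.σ x)) = !t := by
    revert hτ
    cases t <;> cases τ (G.σ (G.σ x)) <;> simp
  -- If `t` holds, the third corner comes first and the exchanged corners find the labels it has
  -- produced; otherwise they find the initial ones.
  have key := M.sum_corners_exchange s (P x) (P (G.α x)) (τ (G.α x))
    (if t then ν (G.σ (G.σ x)) else ℓ (G.σ (G.σ x)))
    (if t then ℓ' (G.σ (G.σ x)) else ν (G.σ (G.σ x))) (ℓ x) (ℓ' x)
    (if t then ν (G.σ x) else ℓ (G.σ x)) (if t then ℓ' (G.σ x) else ν (G.σ x)) (ν (G.α x))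
  refine Eq.trans (Eq.trans ?_ (congrArg (fun z => C * R * R' * z) key)) ?_
  all_goals
    rw [Finset.mul_sum]
    refine Finset.sum_congr rfl fun u _ => ?_
    rw [ht']
    cases t <;> simp only [Bool.not_true, Bool.not_false, if_true, Bool.false_eq_true, if_false] <;> ring

/-! ### Independence of the orders at the vertices -/

variable (G) in
/-- The orders at the individual vertices that `τ` encodes are linear. -/
def Acyclic (τ : D → Bool) : Prop := ∀ d, ¬ (τ d = τ (G.σ d) ∧ τ d = τ (G.σ (G.σ d)))

theorem orderedEntry_update_not [Fintype D] [DecidableEq D] (s : Fin (N + 1)) {P : D → Prop}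
    (hP : ∀ x, P (G.σ (G.σ (G.α x))) ↔ P x) {ω : D → Bool} (hω : ∀ x, ω (G.α x) = !ω x)
    {τ : D → Bool} (x : D) (hτ : τ (G.σ x) ≠ τ (G.σ (G.σ x)))
    {ℓ ℓ' : D → Fin (N + 1)} (hℓ : ∀ x, ℓ (G.α x) = M.star (ℓ x))
    (hℓ' : ∀ x, ℓ' (G.α x) = M.star (ℓ' x)) :
    G.orderedEntry M s P ω τ ℓ' ℓ =
      G.orderedEntry M s P ω (Function.update τ x (!τ x)) ℓ' ℓ := by
  by_cases hx : τ x = true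
  · rw [hx]
    exact orderedEntry_update_false s hP hω x hx hτ hℓ hℓ'
  · rw [Bool.not_eq_true] at hx
    -- A flip from `false` to `true` is undone by the flip already treated.
    have h := orderedEntry_update_false (τ := Function.update τ x true) s hP hω x
      (Function.update_self ..) (by
        rwa [Function.update_of_ne (G.σ_ne x), Function.update_of_ne (G.sigma_sigma_ne x)]) hℓ hℓ'
    rw [hx, Bool.not_false, h, Function.update_idem, ← hx, Function.update_eq_self]

/-- The six nonconstant triples of Booleans form a hexagon, whose edges are the flips that keep a
triple nonconstant. Between two different ones there is always such a flip at a place where they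
differ, as a truth table confirms. -/
theorem exists_dart_to_flip {τ τ' : D → Bool} (h : G.Acyclic τ) (h' : G.Acyclic τ')
    (hne : τ ≠ τ') : ∃ x, τ x ≠ τ' x ∧ τ (G.σ x) ≠ τ (G.σ (G.σ x)) := by
  obtain ⟨y, hy⟩ := Function.ne_iff.1 hne
  have key : ∀ a b c a' b' c' : Bool, ¬ (a = b ∧ a = c) → ¬ (a' = b' ∧ a' = c') → a ≠ a' →
      (a ≠ a' ∧ b ≠ c) ∨ (b ≠ b' ∧ c ≠ a) ∨ (c ≠ c' ∧ a ≠ b) := by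
    intro a b c a' b' c'
    cases a <;> cases b <;> cases c <;> cases a' <;> cases b' <;> cases c' <;> simp
  have c := G.σ_cubed y
  rcases key _ _ _ _ _ _ (h y) (h' y) hy with h1 | h1 | h1
  · exact ⟨y, h1⟩
  · exact ⟨G.σ y, by rwa [c]⟩
  · exact ⟨G.σ (G.σ y), by rwa [c]⟩

theorem Acyclic.update_not [DecidableEq D] {τ : D → Bool} (h : G.Acyclic τ) (x : D)
    (hτ : τ (G.σ x) ≠ τ (G.σ (G.σ x))) : G.Acyclic (Function.update τ x (!τ x)) := by
  intro d
  have n1 := G.σ_ne x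
  have n2 := G.sigma_sigma_ne x
  have c := G.σ_cubed
  by_cases h0 : d = x
  · subst h0
    rw [Function.update_of_ne n1, Function.update_of_ne n2]
    rintro ⟨h1, h2⟩
    exact hτ (h1.symm.trans h2)
  by_cases h1 : G.σ d = x
  · have e1 : G.σ (G.σ d) = G.σ x := by rw [h1]
    have e2 : d = G.σ (G.σ x) := by rw [← h1, c]
    rw [e1, Function.update_of_ne n1, Function.update_of_ne h0, e2]
    rintro ⟨-, h2⟩
    exact hτ h2.symm
  by_cases h2 : G.σ (G.σ d) = x
  · have e2 : d = G.σ x := by rw [← h2, c]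
    rw [Function.update_of_ne h0, Function.update_of_ne h1, e2]
    rintro ⟨h2, -⟩
    exact hτ h2
  rw [Function.update_of_ne h0, Function.update_of_ne h1, Function.update_of_ne h2]
  exact h d

/-- Each admissible flip keeps the order acyclic and removes one disagreement with `τ'`; hence the
induction on the number of disagreements. -/
theorem orderedEntry_eq_of_acyclic [Fintype D] [DecidableEq D] (s : Fin (N + 1)) {P : D → Prop}
    (hP : ∀ x, P (G.σ (G.σ (G.α x))) ↔ P x) {ω : D → Bool} (hω : ∀ x, ω (G.α x) = !ω x)
    {τ τ' : D → Bool} (hτ : G.Acyclic τ) (hτ' : G.Acyclic τ')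
    {ℓ ℓ' : D → Fin (N + 1)} (hℓ : ∀ x, ℓ (G.α x) = M.star (ℓ x))
    (hℓ' : ∀ x, ℓ' (G.α x) = M.star (ℓ' x)) :
    G.orderedEntry M s P ω τ ℓ' ℓ = G.orderedEntry M s P ω τ' ℓ' ℓ := by
  induction hn : (Finset.univ.filter fun x => τ x ≠ τ' x).card using Nat.strong_induction_on
    generalizing τ with
  | _ n ih =>
  by_cases hne : τ = τ'
  · rw [hne]
  obtain ⟨x, hx, hx'⟩ := exists_dart_to_flip hτ hτ' hne
  rw [orderedEntry_update_not s hP hω x hx' hℓ hℓ']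
  refine ih _ ?_ (hτ.update_not x hx') rfl
  rw [← hn]
  apply Finset.card_lt_card
  rw [Finset.ssubset_iff_of_subset]
  · exact ⟨x, by simp [hx], by
      rw [Finset.mem_filter, not_and, not_not, Function.update_self]
      intro _
      revert hx
      cases τ x <;> cases τ' x <;> simp⟩
  · intro y
    by_cases hy : y = x
    · subst hy
      simp [hx]
    · simp [Function.update_of_ne hy]

/-! ### Matrix entries of plaquette operators as ordered entries -/

theorem FusionOrder.first_acyclic (o : G.FusionOrder) : G.Acyclic o.first := o.acyclic

theorem face_sigma_sigma_alpha (p : G.Plaquette) (x : D) :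
    G.face (G.σ (G.σ (G.α x))) = p ↔ G.face x = p := by
  rw [← phi_apply, face_phi]

/-- In a fusion order the two ends of every edge agree. So all transitions are Kronecker deltas,
which restrict the free labels `ν` to labelings. The triviality of the stages outside `p` is
enforced by the deltas at the corners outside `p`. -/
theorem plaquetteEntry_eq_orderedEntry [Fintype D] [DecidableEq D] (o : G.FusionOrder)
    (p : G.Plaquette) (s : Fin (N + 1)) {ω : D → Bool} (hω : ∀ x, ω (G.α x) = !ω x)
    (ℓ' ℓ : G.Labeling M) :
    plaquetteEntry o p s ℓ' ℓ = G.orderedEntry M s (G.face · = p) ω o.first ℓ' ℓ := by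
  classical
  have edge : ∀ ν : D → Fin (N + 1), ∏ x, G.edgeWeight M s (G.face · = p) ω o.first ℓ ν ℓ' x =
      if ∀ x, ν (G.α x) = M.star (ν x) then 1 else 0 := by
    intro ν
    have : ∀ x, G.edgeWeight M s (G.face · = p) ω o.first ℓ ν ℓ' x =
        if ω x = true → ν (G.α x) = M.star (ν x) then 1 else 0 := by
      intro x
      unfold edgeWeight StringNetModel.transition
      rw [o.first_alpha]
      cases ω x <;> simp
    simp only [this]
    split_ifs with h
    · exact Finset.prod_eq_one fun x _ => if_pos fun _ => h x
    · push Not at h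
      obtain ⟨x, hx⟩ := h
      by_cases h1 : ω x = true
      · exact Finset.prod_eq_zero (Finset.mem_univ x) (if_neg fun h => hx (h h1))
      · refine Finset.prod_eq_zero (Finset.mem_univ (G.α x)) (if_neg fun h => hx ?_)
        have := h (by simp [hω, h1])
        rw [G.α_α] at this
        rw [this, M.star_star]
  have labelings : ∀ f : (D → Fin (N + 1)) → ℂ,
      (∑ ν, if ∀ x, ν (G.α x) = M.star (ν x) then f ν else 0) = ∑ μ : G.Labeling M, f μ := by
    intro f
    rw [← Finset.sum_filter]
    exact Finset.sum_subtype (p := fun ν : D → Fin (N + 1) => ∀ x, ν (G.α x) = M.star (ν x))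
      (F := inferInstanceAs (Fintype (G.Labeling M))) _ (by simp) _
  unfold orderedEntry plaquetteEntry
  simp only [edge, mul_ite, mul_one, mul_zero, labelings]
  refine Finset.sum_congr rfl fun μ _ => ?_
  have dual : ∀ (a b : G.Labeling M) x, a (G.α x) = b (G.α x) → a x = b x := fun a b x h => by
    rw [← G.α_α x, a.2, b.2, h]
  have back : ∀ x, o.first x ≠ true → o.first (G.α x) = true := fun x h => by
    rw [o.first_alpha]; simpa using h
  split_ifs with h
  · refine Finset.prod_congr rfl fun x _ => ?_
    unfold cornerWeight StringNetModel.corner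
    by_cases hx : G.face x = p
    · rw [if_pos hx, if_pos hx]
    · rw [if_neg hx, if_neg hx, if_pos]
      -- The corner of `x` also lies to the right of `σ x`.
      have hy : G.face (G.α (G.σ x)) ≠ p := by
        rwa [Ne, ← face_sigma_sigma_alpha, G.α_α, G.σ_cubed]
      constructor
      · by_cases h1 : o.first x = true
        · rw [if_pos h1, if_pos h1, (h x h1).1 hx]
        · rw [if_neg h1, if_neg h1]
          exact (dual _ _ _ ((h _ (back _ h1)).2 (by rwa [G.α_α]))).symm
      · by_cases h1 : o.first (G.σ x) = true
        · rw [if_pos h1, if_pos h1, (h _ h1).2 hy]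
        · rw [if_neg h1, if_neg h1]
          exact (dual _ _ _ ((h _ (back _ h1)).1 hy)).symm
  -- A nontrivial stage outside `p` makes a corner factor vanish: the corner of `x` for the first
  -- stage, that of `α x` for the second.
  · push Not at h
    obtain ⟨x, hx, h⟩ := h
    by_cases h1 : G.face x ≠ p → μ x = ℓ x
    · obtain ⟨h2, h3⟩ := h h1
      refine (Finset.prod_eq_zero (Finset.mem_univ (G.α x)) ?_).symm
      unfold cornerWeight
      rw [M.corner_false h2, o.first_alpha, hx, if_neg]
      simp only [Bool.not_true, Bool.false_eq_true, if_false]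
      exact fun h => h3 (dual _ _ _ h.1).symm
    · push Not at h1
      refine (Finset.prod_eq_zero (Finset.mem_univ x) ?_).symm
      unfold cornerWeight
      rw [M.corner_false h1.1, hx, if_neg]
      simp only [if_true]
      exact fun h => h1.2 h.1.symm

/-! ### The reconnected graph -/

theorem fmove_sigma [DecidableEq D] {e : D} (he : ¬ G.IsLoop e) :
    (G.fmove e).σ e = G.σ (G.σ (G.α e)) ∧
    (G.fmove e).σ (G.σ (G.σ (G.α e))) = G.σ e ∧
    (G.fmove e).σ (G.σ e) = e ∧
    (G.fmove e).σ (G.α e) = G.σ (G.σ e) ∧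
    (G.fmove e).σ (G.σ (G.σ e)) = G.σ (G.α e) ∧
    (G.fmove e).σ (G.σ (G.α e)) = G.α e := by
  obtain ⟨p1, p2, p3, p4, p5, p6⟩ := G.legShift_apply he
  have s1 := G.fmove_sigma_legShift (e := e) e
  have s2 := G.fmove_sigma_legShift (e := e) (G.σ e)
  have s3 := G.fmove_sigma_legShift (e := e) (G.σ (G.σ e))
  have s4 := G.fmove_sigma_legShift (e := e) (G.α e)
  have s5 := G.fmove_sigma_legShift (e := e) (G.σ (G.α e))
  have s6 := G.fmove_sigma_legShift (e := e) (G.σ (G.σ (G.α e)))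
  rw [G.σ_cubed] at s3 s6
  rw [p1, p2] at s1
  rw [p2, p3] at s2
  rw [p3, p1] at s3
  rw [p4, p5] at s4
  rw [p5, p6] at s5
  rw [p6, p4] at s6
  exact ⟨s1, s2, s3, s4, s5, s6⟩

variable (G) in
/-- The darts at the two ends of the edge of `e`. -/
def endDarts [DecidableEq D] (e : D) : Finset D :=
  {e, G.σ e, G.σ (G.σ e), G.α e, G.σ (G.α e), G.σ (G.σ (G.α e))}

theorem sigma_mem_endDarts [DecidableEq D] {e x : D} :
    G.σ x ∈ G.endDarts e ↔ x ∈ G.endDarts e := by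
  have c := G.σ_cubed
  have inj := fun {a b} => G.σ.injective.eq_iff (a := a) (b := b)
  have h1 : G.σ x = e ↔ x = G.σ (G.σ e) :=
    ⟨fun h => by rw [← h, c], fun h => by rw [h, c]⟩
  have h2 : G.σ x = G.α e ↔ x = G.σ (G.σ (G.α e)) :=
    ⟨fun h => by rw [← h, c], fun h => by rw [h, c]⟩
  simp only [endDarts, Finset.mem_insert, Finset.mem_singleton, inj, h1, h2]
  tauto

theorem fmove_sigma_of_notMem [DecidableEq D] {e x : D} (hx : x ∉ G.endDarts e) :
    (G.fmove e).σ x = G.σ x := by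
  have hx' := sigma_mem_endDarts.not.2 hx
  simp only [endDarts, Finset.mem_insert, Finset.mem_singleton, not_or] at hx hx'
  have h := G.fmove_sigma_legShift (e := e) x
  rwa [G.legShift_apply_of_ne, G.legShift_apply_of_ne] at h <;> tauto

theorem prod_endDarts [Fintype D] [DecidableEq D] {e : D} (he : ¬ G.IsLoop e) (f : D → ℂ) :
    ∏ x, f x = f e * f (G.σ e) * f (G.σ (G.σ e)) *
      (f (G.α e) * f (G.σ (G.α e)) * f (G.σ (G.σ (G.α e)))) *
        ∏ x ∈ (G.endDarts e)ᶜ, f x := by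
  obtain ⟨⟨h0, h1, h2⟩, ⟨h3, h4, h5⟩, ⟨h6, h7, h8⟩⟩ := G.ne_of_not_isLoop he
  have a1 := G.σ_ne e
  have a2 := G.σ_ne (G.σ e)
  have a3 := G.sigma_sigma_ne e
  have b1 := G.σ_ne (G.α e)
  have b2 := G.σ_ne (G.σ (G.α e))
  have b3 := G.sigma_sigma_ne (G.α e)
  rw [← Finset.prod_mul_prod_compl (G.endDarts e), endDarts, Finset.prod_insert,
    Finset.prod_insert, Finset.prod_insert, Finset.prod_insert, Finset.prod_pair b2.symm]
  · ring
  all_goals simp only [Finset.mem_insert, Finset.mem_singleton, not_or]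
  · exact ⟨b1.symm, b3.symm⟩
  · exact ⟨h2.symm, h5.symm, h8.symm⟩
  · exact ⟨a2.symm, h1.symm, h4.symm, h7.symm⟩
  · exact ⟨a1.symm, a3.symm, h0.symm, h3.symm, h6.symm⟩

theorem fmove_face_of_edge [DecidableEq D] {e : D} (he : ¬ G.IsLoop e) :
    (G.fmove e).face e = (G.fmove e).face (G.σ (G.α e)) ∧
    (G.fmove e).face (G.α e) = (G.fmove e).face (G.σ e) := by
  obtain ⟨s1, s2, s3, s4, s5, s6⟩ := fmove_sigma he
  rw [← (G.fmove e).face_phi e, ← (G.fmove e).face_phi (G.α e), G.fmove_phi_eq s6,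
    G.fmove_phi_eq (s3.trans (G.α_α e).symm)]
  exact ⟨rfl, rfl⟩

/-- The point is that different plaquettes stay different. The map `g` back to the old plaquettes is
constant on the new boundary walks; on the reconnected edge its values are the old plaquettes that
the edge now separates. -/
theorem fmove_face_eq_iff [DecidableEq D] {e : D} (he : ¬ G.IsLoop e) (p : G.Plaquette) {x : D}
    (h1 : x ≠ e) (h2 : x ≠ G.α e) :
    (G.fmove e).face x = G.movePlaquette he p ↔ G.face x = p := by
  classical
  obtain ⟨⟨h0, n1, n2⟩, ⟨n3, n4, n5⟩, ⟨n6, n7, n8⟩⟩ := G.ne_of_not_isLoop he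
  have a1 := G.σ_ne e
  have a3 := G.sigma_sigma_ne e
  have b1 := G.σ_ne (G.α e)
  have b3 := G.sigma_sigma_ne (G.α e)
  have c := G.σ_cubed
  have hp := G.phi_apply
  refine ⟨fun h => ?_, fun h => by rw [← h, G.movePlaquette_face he h1 h2]⟩
  let g : D → G.Plaquette := fun d =>
    if d = e then G.face (G.σ (G.α e)) else if d = G.α e then G.face (G.σ e) else G.face d
  have g_off : ∀ d, d ≠ e → d ≠ G.α e → g d = G.face d := fun d h h' => by
    simp only [g, if_neg h, if_neg h']
  have g_e : g e = G.face (G.σ (G.α e)) := if_pos rfl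
  have g_α : g (G.α e) = G.face (G.σ e) := by simp only [g, if_neg h0, if_true]
  obtain ⟨s1, s2, s3, s4, s5, s6⟩ := fmove_sigma he
  have g_phi : ∀ d, g ((G.fmove e).φ d) = g d := by
    intro d
    by_cases d1 : d = e
    · rw [d1, G.fmove_phi_eq s6, g_e, g_off _ n3 b1]
    by_cases d2 : d = G.α e
    · rw [d2, G.fmove_phi_eq (s3.trans (G.α_α e).symm), g_α, g_off _ a1 n1.symm]
    rw [g_off d d1 d2]
    by_cases c1 : G.α d = G.σ e
    · rw [G.fmove_phi_eq (s2.trans c1.symm), g_off _ n6 b3, ← G.face_phi d, hp, c1, c,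
        ← G.face_phi e, hp]
    by_cases c2 : G.α d = G.σ (G.σ e)
    · rw [G.fmove_phi_eq (s4.trans c2.symm), g_α, ← G.face_phi d, hp, c2, c]
    by_cases c3 : G.α d = G.σ (G.α e)
    · rw [G.fmove_phi_eq (s5.trans c3.symm), g_off _ a3 n2.symm, ← G.face_phi d, hp, c3, c,
        ← G.face_phi (G.α e), hp, G.α_α]
    by_cases c4 : G.α d = G.σ (G.σ (G.α e))
    · rw [G.fmove_phi_eq (s1.trans c4.symm), g_e, ← G.face_phi d, hp, c4, c]
    have hα : G.α d ∉ G.endDarts e := by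
      simp only [endDarts, Finset.mem_insert, Finset.mem_singleton, not_or]
      exact ⟨fun h => d2 (by rw [← h, G.α_α]), c1, c2, fun h => d1 (G.α.injective h), c3, c4⟩
    have hφ : G.φ d ∉ G.endDarts e := by rwa [hp, sigma_mem_endDarts, sigma_mem_endDarts]
    rw [G.fmove_phi_eq (y := G.φ d) (by rw [fmove_sigma_of_notMem hφ, hp, c])]
    simp only [endDarts, Finset.mem_insert, Finset.mem_singleton, not_or] at hφ
    rw [g_off _ hφ.1 hφ.2.2.2.1, G.face_phi]
  have g_cycle : ∀ a b, (G.fmove e).face a = (G.fmove e).face b → g a = g b := by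
    intro a b hab
    obtain ⟨k, rfl⟩ := Quotient.exact (s := SameCycle.setoid (G.fmove e).φ) hab
    clear hab
    induction k using Int.induction_on with
    | zero => rfl
    | succ n ih => rw [ih, add_comm, zpow_one_add, Perm.mul_apply, g_phi]
    | pred n ih =>
      rw [ih, ← g_phi (((G.fmove e).φ ^ (-(n : ℤ) - 1)) a), ← Perm.mul_apply, ← zpow_one_add,
        add_sub_cancel]
  induction p using Quotient.inductionOn with
  | _ d =>
  -- As the edge is not a loop, a boundary walk leaves it after one step, so every plaquette has a
  -- dart off this edge.
  obtain ⟨y, hy, y1, y2⟩ : ∃ y, G.face y = G.face d ∧ y ≠ e ∧ y ≠ G.α e := by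
    by_cases d1 : d = e
    · exact ⟨_, G.face_phi d, by rw [hp, d1]; exact n6, by rw [hp, d1]; exact b3⟩
    by_cases d2 : d = G.α e
    · exact ⟨_, G.face_phi d, by rw [hp, d2, G.α_α]; exact a3,
        by rw [hp, d2, G.α_α]; exact n2.symm⟩
    exact ⟨d, rfl, d1, d2⟩
  change _ = G.movePlaquette he (G.face d) at h
  change _ = G.face d
  rw [← hy, G.movePlaquette_face he y1 y2] at h
  rw [← hy, ← g_off x h1 h2, g_cycle _ _ h, g_off y y1 y2]

/-! ### Plaquette operators and F-moves -/

theorem sum_eq_of_sum_update_update {ι β : Type*} [Fintype ι] [DecidableEq ι] [Fintype β]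
    [Nonempty β] (x y : ι) {f g : (ι → β) → ℂ}
    (h : ∀ ν, ∑ u, ∑ w, f (Function.update (Function.update ν x u) y w) =
      ∑ u, ∑ w, g (Function.update (Function.update ν x u) y w)) :
    ∑ ν, f ν = ∑ ν, g ν := by
  have hc : (Fintype.card β : ℂ) ≠ 0 := by simp
  apply mul_left_cancel₀ hc
  simp only [card_mul_sum y]
  exact sum_eq_of_sum_update x h

variable (G M) in
/-- The labels that agree with `ℓ` except that the label of the edge of `e` is `m`. -/
def relabel [DecidableEq D] (e : D) (m : Fin (N + 1)) (ℓ : D → Fin (N + 1)) : D → Fin (N + 1) :=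
  Function.update (Function.update ℓ e m) (G.α e) (M.star m)

theorem relabel_self [DecidableEq D] (e : D) (m : Fin (N + 1)) (ℓ : D → Fin (N + 1)) :
    G.relabel M e m ℓ e = m := by
  rw [relabel, Function.update_of_ne (G.α_ne e).symm, Function.update_self]

theorem relabel_alpha [DecidableEq D] (e : D) (m : Fin (N + 1)) (ℓ : D → Fin (N + 1)) :
    G.relabel M e m ℓ (G.α e) = M.star m := Function.update_self ..

theorem relabel_of_ne [DecidableEq D] {e x : D} (m : Fin (N + 1)) (ℓ : D → Fin (N + 1))
    (h1 : x ≠ e) (h2 : x ≠ G.α e) : G.relabel M e m ℓ x = ℓ x := by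
  rw [relabel, Function.update_of_ne h2, Function.update_of_ne h1]

theorem relabel_dual [DecidableEq D] (e : D) (m : Fin (N + 1)) {ℓ : D → Fin (N + 1)}
    (hℓ : ∀ x, ℓ (G.α x) = M.star (ℓ x)) (x : D) :
    G.relabel M e m ℓ (G.α x) = M.star (G.relabel M e m ℓ x) := by
  by_cases h1 : x = e
  · rw [h1, relabel_alpha, relabel_self]
  by_cases h2 : x = G.α e
  · rw [h2, relabel_alpha, G.α_α, relabel_self, M.star_star]
  rw [relabel_of_ne _ _ h1 h2, relabel_of_ne, hℓ]
  · exact fun h => h2 (by rw [← h, G.α_α])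
  · exact fun h => h1 (G.α.injective h)

/-- The sum over the labelings that agree with a given one outside the edge of `e`. -/
theorem sum_agree_off_edge [Fintype D] [DecidableEq D] (e : D) (ℓ : G.Labeling M)
    [DecidablePred fun ℓ' : G.Labeling M => ∀ x, x ≠ e → x ≠ G.α e → ℓ x = ℓ' x]
    (f : (D → Fin (N + 1)) → ℂ) :
    (∑ ℓ' : G.Labeling M, if ∀ x, x ≠ e → x ≠ G.α e → ℓ x = ℓ' x then f ℓ' else 0) =
      ∑ m, f (G.relabel M e m ℓ) := by
  rw [← Finset.sum_filter]
  refine Finset.sum_bij' (fun ℓ' _ => ℓ' e)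
    (fun m _ => ⟨G.relabel M e m ℓ, relabel_dual e m ℓ.2⟩) ?_ ?_ ?_ ?_ ?_
  · simp
  · intro m _
    exact Finset.mem_filter.2
      ⟨Finset.mem_univ _, fun x h1 h2 => (relabel_of_ne m _ h1 h2).symm⟩
  · intro ℓ' h
    rw [Finset.mem_filter] at h
    apply Subtype.ext
    funext x
    by_cases h1 : x = e
    · rw [h1]; exact relabel_self ..
    by_cases h2 : x = G.α e
    · rw [h2, ℓ'.2]; exact relabel_alpha ..
    exact (relabel_of_ne _ _ h1 h2).trans (h.2 x h1 h2)
  · intro m _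
    exact relabel_self ..
  · intro ℓ' h
    rw [Finset.mem_filter] at h
    congr 1
    funext x
    by_cases h1 : x = e
    · rw [h1]; exact (relabel_self ..).symm
    by_cases h2 : x = G.α e
    · rw [h2, ℓ'.2]; exact (relabel_alpha ..).symm
    exact ((relabel_of_ne _ _ h1 h2).trans (h.2 x h1 h2)).symm

theorem sum_star_collapse (F : Fin (N + 1) → ℂ)
    (T : Fin (N + 1) → Fin (N + 1) → Fin (N + 1) → ℂ) (R E : ℂ) :
    ∑ u, ∑ w, ∑ m, F m * (T u w m * R * ((if w = M.star u then 1 else 0) * E)) =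
      R * E * ∑ m, ∑ u, F m * T u (M.star u) m := by
  have h : ∀ u, ∑ w, ∑ m, F m * (T u w m * R * ((if w = M.star u then 1 else 0) * E)) =
      ∑ m, R * E * (F m * T u (M.star u) m) := by
    intro u
    rw [Finset.sum_eq_single (M.star u)]
    · exact Finset.sum_congr rfl fun m _ => by rw [if_pos rfl]; ring
    · intro w _ hw
      simp [hw]
    · simp
  simp only [h]
  rw [Finset.sum_comm]
  simp only [Finset.mul_sum]

/-- Factors away from the two ends are identical in both graphs. The values of `τ` and `τ'` at the
ends put the loops originally beside the edge before the others, both before and after the move, as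
`fmove_corners` requires. They also make the orders at the two ends of the edge agree, so that its
transition is a Kronecker delta. -/
theorem orderedEntry_fmove [Fintype D] [DecidableEq D] {e : D} (he : ¬ G.IsLoop e)
    (s : Fin (N + 1)) {P P' : D → Prop} (hPP : ∀ x, x ≠ e → x ≠ G.α e → P' x = P x)
    (hPe : P' e = P (G.σ (G.α e))) (hPα : P' (G.α e) = P (G.σ e))
    (hP : ∀ x, P (G.σ (G.σ (G.α x))) = P x)
    {ω : D → Bool} (hω : ∀ x, ω (G.α x) = !ω x) {τ τ' : D → Bool}
    (hττ : ∀ x, x ≠ e → x ≠ G.α e → τ' x = τ x)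
    (t1 : τ e = true) (t2 : τ (G.α e) = false) (t3 : τ (G.σ e) = false)
    (t4 : τ (G.σ (G.σ e)) = true) (t5 : τ (G.σ (G.α e)) = false)
    (t6 : τ (G.σ (G.σ (G.α e))) = true) (t7 : τ' e = false) (t8 : τ' (G.α e) = true)
    {ℓ ℓ' : D → Fin (N + 1)} (hℓ : ∀ x, ℓ (G.α x) = M.star (ℓ x))
    (hℓ' : ∀ x, ℓ' (G.α x) = M.star (ℓ' x)) :
    ∑ m, M.F (ℓ' (G.σ e)) (ℓ' (G.σ (G.σ e))) m (ℓ' (G.σ (G.α e))) (ℓ' (G.σ (G.σ (G.α e)))) (ℓ' e) *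
      G.orderedEntry M s P ω τ (G.relabel M e m ℓ') ℓ =
    ∑ m, M.F (ℓ (G.σ e)) (ℓ (G.σ (G.σ e))) (ℓ e) (ℓ (G.σ (G.α e))) (ℓ (G.σ (G.σ (G.α e)))) m *
      (G.fmove e).orderedEntry M s P' ω τ' ℓ' (G.relabel M e m ℓ) := by
  obtain ⟨⟨h0, n1, n2⟩, ⟨n3, n4, n5⟩, ⟨n6, n7, n8⟩⟩ := G.ne_of_not_isLoop he
  have a1 := G.σ_ne e
  have a3 := G.sigma_sigma_ne e
  have b1 := G.σ_ne (G.α e)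
  have b3 := G.sigma_sigma_ne (G.α e)
  have c := G.σ_cubed
  have hα : (G.fmove e).α = G.α := rfl
  obtain ⟨s1, s2, s3, s4, s5, s6⟩ := fmove_sigma he
  have q1 : P (G.σ (G.σ (G.α e))) = P e := hP e
  have q2 : P (G.σ (G.σ e)) = P (G.α e) := by rw [← hP (G.α e), G.α_α]
  have r1 := hττ _ a1 n1.symm
  have r2 := hττ _ a3 n2.symm
  have r3 := hττ _ n3 b1
  have r4 := hττ _ n6 b3
  rw [t3] at r1
  rw [t4] at r2
  rw [t5] at r3
  rw [t6] at r4
  have p1 := hPP _ a1 n1.symm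
  have p2 := hPP _ a3 n2.symm
  have p3 := hPP _ n3 b1
  have p4 := hPP _ n6 b3
  simp only [orderedEntry, Finset.mul_sum]
  rw [Finset.sum_comm, Finset.sum_comm (s := Finset.univ (α := Fin (N + 1)))]
  -- Only the intermediate labels on the reconnected edge are summed; those on the legs and
  -- elsewhere can be held fixed.
  refine sum_eq_of_sum_update_update e (G.α e) fun ν => ?_
  have off : ∀ {x}, x ∈ ({e, G.α e} : Finset D)ᶜ → x ≠ e ∧ x ≠ G.α e := fun hx => by
    simpa only [Finset.mem_compl, Finset.mem_insert, Finset.mem_singleton, not_or] using hx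
  have val_e : ∀ u w, Function.update (Function.update ν e u) (G.α e) w e = u := fun u w => by
    rw [Function.update_of_ne h0.symm, Function.update_self]
  have val_off : ∀ u w x, x ≠ e → x ≠ G.α e →
      Function.update (Function.update ν e u) (G.α e) w x = ν x := fun u w x h1 h2 => by
    rw [Function.update_of_ne h2, Function.update_of_ne h1]
  have corners : ∀ u w m, ∏ x, G.cornerWeight M s P τ ℓ
      (Function.update (Function.update ν e u) (G.α e) w) (G.relabel M e m ℓ') x = _ :=
    fun u w m => prod_endDarts he _
  have corners' : ∀ u w m, ∏ x, (G.fmove e).cornerWeight M s P' τ' (G.relabel M e m ℓ)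
      (Function.update (Function.update ν e u) (G.α e) w) ℓ' x = _ :=
    fun u w m => prod_endDarts he _
  have edges : ∀ u w m, ∏ x, G.edgeWeight M s P ω τ ℓ
      (Function.update (Function.update ν e u) (G.α e) w) (G.relabel M e m ℓ') x =
      (if w = M.star u then 1 else 0) *
        ∏ x ∈ ({e, G.α e} : Finset D)ᶜ, G.edgeWeight M s P ω τ ℓ ν ℓ' x := by
    intro u w m
    rw [prod_edge (G := G) _ e, edgeWeight_mul_alpha s P hω _ _ _ (hℓ e) (relabel_dual e m hℓ' e),
      t1, t2, val_e, Function.update_self]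
    congr 1
    refine Finset.prod_congr rfl fun x hx => ?_
    obtain ⟨h1, h2⟩ := off hx
    have h3 : G.α x ≠ e := fun h => h2 (by rw [← h, G.α_α])
    have h4 : G.α x ≠ G.α e := fun h => h1 (G.α.injective h)
    unfold edgeWeight
    rw [val_off _ _ _ h1 h2, val_off _ _ _ h3 h4, relabel_of_ne _ _ h1 h2]
  have edges' : ∀ u w m, ∏ x, (G.fmove e).edgeWeight M s P' ω τ' (G.relabel M e m ℓ)
      (Function.update (Function.update ν e u) (G.α e) w) ℓ' x =
      (if w = M.star u then 1 else 0) *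
        ∏ x ∈ ({e, G.α e} : Finset D)ᶜ, G.edgeWeight M s P ω τ ℓ ν ℓ' x := by
    intro u w m
    rw [prod_edge (G := G.fmove e) _ e, edgeWeight_mul_alpha (G := G.fmove e) s P' hω _ _ _
      (relabel_dual e m hℓ e) (hℓ' e), hα, t7, t8, val_e, Function.update_self]
    congr 1
    refine Finset.prod_congr rfl fun x hx => ?_
    obtain ⟨h1, h2⟩ := off hx
    have h3 : G.α x ≠ e := fun h => h2 (by rw [← h, G.α_α])
    have h4 : G.α x ≠ G.α e := fun h => h1 (G.α.injective h)
    unfold edgeWeight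
    rw [hα, val_off _ _ _ h1 h2, val_off _ _ _ h3 h4, relabel_of_ne _ _ h1 h2, hPP _ h1 h2,
      hPP _ h3 h4, hττ _ h1 h2, hττ _ h3 h4]
  have mem_off : ∀ {x}, x ∈ (G.endDarts e)ᶜ → x ≠ e ∧ x ≠ G.α e := fun hx => by
    simp only [endDarts, Finset.mem_compl, Finset.mem_insert, Finset.mem_singleton, not_or] at hx
    exact ⟨hx.1, hx.2.2.2.1⟩
  have mem_sigma : ∀ {x}, x ∈ (G.endDarts e)ᶜ → G.σ x ∈ (G.endDarts e)ᶜ := fun hx => by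
    rwa [Finset.mem_compl, sigma_mem_endDarts, ← Finset.mem_compl]
  have rest : ∀ u w m, ∏ x ∈ (G.endDarts e)ᶜ, G.cornerWeight M s P τ ℓ
      (Function.update (Function.update ν e u) (G.α e) w) (G.relabel M e m ℓ') x =
      ∏ x ∈ (G.endDarts e)ᶜ, G.cornerWeight M s P τ ℓ ν ℓ' x := by
    intro u w m
    refine Finset.prod_congr rfl fun x hx => ?_
    obtain ⟨h1, h2⟩ := mem_off hx
    obtain ⟨h3, h4⟩ := mem_off (mem_sigma hx)
    obtain ⟨h5, h6⟩ := mem_off (mem_sigma (mem_sigma hx))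
    unfold cornerWeight
    rw [val_off _ _ _ h1 h2, val_off _ _ _ h3 h4, val_off _ _ _ h5 h6, relabel_of_ne _ _ h1 h2,
      relabel_of_ne _ _ h3 h4, relabel_of_ne _ _ h5 h6]
  have rest' : ∀ u w m, ∏ x ∈ (G.endDarts e)ᶜ, (G.fmove e).cornerWeight M s P' τ'
      (G.relabel M e m ℓ) (Function.update (Function.update ν e u) (G.α e) w) ℓ' x =
      ∏ x ∈ (G.endDarts e)ᶜ, G.cornerWeight M s P τ ℓ ν ℓ' x := by
    intro u w m
    refine Finset.prod_congr rfl fun x hx => ?_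
    obtain ⟨h1, h2⟩ := mem_off hx
    obtain ⟨h3, h4⟩ := mem_off (mem_sigma hx)
    obtain ⟨h5, h6⟩ := mem_off (mem_sigma (mem_sigma hx))
    unfold cornerWeight
    rw [fmove_sigma_of_notMem (Finset.mem_compl.1 hx),
      fmove_sigma_of_notMem (Finset.mem_compl.1 (mem_sigma hx)),
      val_off _ _ _ h1 h2, val_off _ _ _ h3 h4, val_off _ _ _ h5 h6, relabel_of_ne _ _ h1 h2,
      relabel_of_ne _ _ h3 h4, relabel_of_ne _ _ h5 h6, hPP _ h1 h2, hττ _ h1 h2, hττ _ h3 h4]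
  simp only [corners, corners', edges, edges', rest, rest']
  rw [sum_star_collapse (M := M), sum_star_collapse (M := M)]
  congr 1
  have key := M.fmove_corners s (P e) (P (G.α e)) (P (G.σ e)) (P (G.σ (G.α e)))
    (ℓ (G.σ e)) (ℓ (G.σ (G.σ e))) (ℓ (G.σ (G.α e))) (ℓ (G.σ (G.σ (G.α e))))
    (ν (G.σ e)) (ν (G.σ (G.σ e))) (ν (G.σ (G.α e))) (ν (G.σ (G.σ (G.α e))))
    (ℓ' (G.σ e)) (ℓ' (G.σ (G.σ e))) (ℓ' (G.σ (G.α e))) (ℓ' (G.σ (G.σ (G.α e))))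
    (ℓ e) (ℓ' e)
  refine Eq.trans ?_ (key.trans ?_)
  · refine Finset.sum_congr rfl fun m _ => Finset.sum_congr rfl fun u _ => ?_
    simp only [cornerWeight, c, t1, t2, t3, t4, t5, t6, if_true, if_false, Bool.false_eq_true, val_e,
      Function.update_self, relabel_self, relabel_alpha, val_off _ _ _ a1 n1.symm,
      val_off _ _ _ a3 n2.symm, val_off _ _ _ n3 b1, val_off _ _ _ n6 b3,
      relabel_of_ne _ _ a1 n1.symm, relabel_of_ne _ _ a3 n2.symm, relabel_of_ne _ _ n3 b1,
      relabel_of_ne _ _ n6 b3, q1, q2, hℓ e]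
  · refine Finset.sum_congr rfl fun m _ => Finset.sum_congr rfl fun u _ => ?_
    simp only [cornerWeight, s1, s2, s3, s4, s5, s6, r1, r2, r3, r4, t7, t8, if_true, if_false,
      Bool.false_eq_true, val_e,
      Function.update_self, relabel_self, relabel_alpha, val_off _ _ _ a1 n1.symm,
      val_off _ _ _ a3 n2.symm, val_off _ _ _ n3 b1, val_off _ _ _ n6 b3,
      relabel_of_ne _ _ a1 n1.symm, relabel_of_ne _ _ a3 n2.symm, relabel_of_ne _ _ n3 b1,
      relabel_of_ne _ _ n6 b3, p1, p2, p3, p4, hPe, hPα, q1, q2, hℓ' e]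
    ring

/-! ### Orders adapted to the reconnected edge -/

/-- The orders `τ` with a prescribed order at the two ends of the edge of `e`. -/
def endOrder [DecidableEq D] (G : TrivalentMap D) (e : D) (τ : D → Bool) (x : D) : Bool :=
  if x ∈ G.endDarts e then
    decide (x = e ∨ x = G.σ (G.σ e) ∨ x = G.σ (G.σ (G.α e)))
  else τ x

/-- The orders in the reconnected graph that correspond to `G.endOrder e τ`. -/
def fmoveEndOrder [DecidableEq D] (G : TrivalentMap D) (e : D) (τ : D → Bool) (x : D) : Bool :=
  if x = e then false else if x = G.α e then true else G.endOrder e τ x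

theorem endOrder_values [DecidableEq D] {e : D} (he : ¬ G.IsLoop e) (τ : D → Bool) :
    G.endOrder e τ e = true ∧ G.endOrder e τ (G.σ e) = false ∧
    G.endOrder e τ (G.σ (G.σ e)) = true ∧ G.endOrder e τ (G.α e) = false ∧
    G.endOrder e τ (G.σ (G.α e)) = false ∧ G.endOrder e τ (G.σ (G.σ (G.α e))) = true := by
  obtain ⟨⟨h0, n1, n2⟩, ⟨n3, n4, n5⟩, ⟨n6, n7, n8⟩⟩ := G.ne_of_not_isLoop he
  have a1 := G.σ_ne e
  have a2 := G.σ_ne (G.σ e)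
  have b2 := G.σ_ne (G.σ (G.α e))
  have b3 := G.sigma_sigma_ne (G.α e)
  simp [endOrder, endDarts, h0, n2, n3, n5, n7.symm, a1, a2.symm, b2.symm, b3.symm]

theorem endOrder_acyclic [DecidableEq D] {e : D} (he : ¬ G.IsLoop e) {τ : D → Bool}
    (hτ : G.Acyclic τ) : G.Acyclic (G.endOrder e τ) := by
  obtain ⟨t1, t2, t3, t4, t5, t6⟩ := endOrder_values he τ
  have c := G.σ_cubed
  intro d
  by_cases hd : d ∈ G.endDarts e
  · simp only [endDarts, Finset.mem_insert, Finset.mem_singleton] at hd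
    rcases hd with rfl | rfl | rfl | rfl | rfl | rfl <;> simp [c, t1, t2, t3, t4, t5, t6]
  · have h1 := sigma_mem_endDarts.not.2 hd
    have h2 := sigma_mem_endDarts.not.2 h1
    rw [endOrder, endOrder, endOrder, if_neg hd, if_neg h1, if_neg h2]
    exact hτ d

theorem fmoveEndOrder_of_ne [DecidableEq D] {e x : D} (τ : D → Bool) (h1 : x ≠ e)
    (h2 : x ≠ G.α e) : G.fmoveEndOrder e τ x = G.endOrder e τ x := by
  rw [fmoveEndOrder, if_neg h1, if_neg h2]

theorem fmoveEndOrder_self [DecidableEq D] (e : D) (τ : D → Bool) :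
    G.fmoveEndOrder e τ e = false := if_pos rfl

theorem fmoveEndOrder_alpha [DecidableEq D] (e : D) (τ : D → Bool) :
    G.fmoveEndOrder e τ (G.α e) = true := by
  rw [fmoveEndOrder, if_neg (G.α_ne e), if_pos rfl]

theorem fmoveEndOrder_acyclic [DecidableEq D] {e : D} (he : ¬ G.IsLoop e) {τ : D → Bool}
    (hτ : G.Acyclic τ) : (G.fmove e).Acyclic (G.fmoveEndOrder e τ) := by
  obtain ⟨t1, t2, t3, t4, t5, t6⟩ := endOrder_values he τ
  obtain ⟨⟨h0, n1, n2⟩, ⟨n3, n4, n5⟩, ⟨n6, n7, n8⟩⟩ := G.ne_of_not_isLoop he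
  obtain ⟨s1, s2, s3, s4, s5, s6⟩ := fmove_sigma he
  have r1 := fmoveEndOrder_of_ne τ (G.σ_ne e) n1.symm
  have r2 := fmoveEndOrder_of_ne τ (G.sigma_sigma_ne e) n2.symm
  have r3 := fmoveEndOrder_of_ne τ n3 (G.σ_ne (G.α e))
  have r4 := fmoveEndOrder_of_ne τ n6 (G.sigma_sigma_ne (G.α e))
  have r5 := G.fmoveEndOrder_self e τ
  have r6 := G.fmoveEndOrder_alpha e τ
  intro d
  by_cases hd : d ∈ G.endDarts e
  · simp only [endDarts, Finset.mem_insert, Finset.mem_singleton] at hd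
    rcases hd with rfl | rfl | rfl | rfl | rfl | rfl <;>
      simp [s1, s2, s3, s4, s5, s6, r1, r2, r3, r4, r5, r6, t2, t3, t5, t6]
  · have h1 := sigma_mem_endDarts.not.2 hd
    have h2 := sigma_mem_endDarts.not.2 h1
    have off : ∀ {x}, x ∉ G.endDarts e → G.fmoveEndOrder e τ x = τ x := fun {x} hx => by
      have hx' := hx
      simp only [endDarts, Finset.mem_insert, Finset.mem_singleton, not_or] at hx'
      rw [fmoveEndOrder_of_ne _ hx'.1 hx'.2.2.2.1, endOrder, if_neg hx]
    rw [fmove_sigma_of_notMem hd, fmove_sigma_of_notMem h1, off hd, off h1, off h2]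
    exact hτ d

/-- Each of the two given orders may be replaced by an adapted one. The choice of one dart per edge
can be shared, because both graphs have the same `α`. -/
theorem fmove_plaquetteEntry [Fintype D] [DecidableEq D] {e : D} (he : ¬ G.IsLoop e)
    (p : G.Plaquette) (o : G.FusionOrder) (o' : (G.fmove e).FusionOrder) (s : Fin (N + 1))
    {ℓ ℓ' : D → Fin (N + 1)} (hℓ : ∀ x, ℓ (G.α x) = M.star (ℓ x))
    (hℓ' : ∀ x, ℓ' (G.α x) = M.star (ℓ' x)) :
    ∑ m, M.F (ℓ' (G.σ e)) (ℓ' (G.σ (G.σ e))) m (ℓ' (G.σ (G.α e))) (ℓ' (G.σ (G.σ (G.α e)))) (ℓ' e) *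
      G.orderedEntry M s (G.face · = p) o.first o.first (G.relabel M e m ℓ') ℓ =
    ∑ m, M.F (ℓ (G.σ e)) (ℓ (G.σ (G.σ e))) (ℓ e) (ℓ (G.σ (G.α e))) (ℓ (G.σ (G.σ (G.α e)))) m *
      (G.fmove e).orderedEntry M s ((G.fmove e).face · = G.movePlaquette he p) o.first o'.first ℓ'
        (G.relabel M e m ℓ) := by
  have hω := o.first_alpha
  obtain ⟨⟨h0, n1, n2⟩, ⟨n3, n4, n5⟩, ⟨n6, n7, n8⟩⟩ := G.ne_of_not_isLoop he
  obtain ⟨t1, t2, t3, t4, t5, t6⟩ := endOrder_values he o.first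
  obtain ⟨f1, f2⟩ := fmove_face_of_edge he
  have key := orderedEntry_fmove he s (M := M) (P := (G.face · = p))
    (P' := ((G.fmove e).face · = G.movePlaquette he p))
    (fun x h1 h2 => propext (fmove_face_eq_iff he p h1 h2))
    (by rw [f1]; exact propext (fmove_face_eq_iff he p n3 (G.σ_ne _)))
    (by rw [f2]; exact propext (fmove_face_eq_iff he p (G.σ_ne _) n1.symm))
    (fun x => propext (face_sigma_sigma_alpha p x)) hω
    (fun x h1 h2 => fmoveEndOrder_of_ne o.first h1 h2) t1 t4 t2 t3 t5 t6
    (fmoveEndOrder_self e _) (fmoveEndOrder_alpha e _) hℓ hℓ'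
  refine Eq.trans ?_ (key.trans ?_)
  · refine Finset.sum_congr rfl fun m _ => congrArg _ ?_
    exact orderedEntry_eq_of_acyclic s (face_sigma_sigma_alpha p) hω o.first_acyclic
      (endOrder_acyclic he o.first_acyclic) hℓ (relabel_dual e m hℓ')
  · refine Finset.sum_congr rfl fun m _ => congrArg _ ?_
    exact (orderedEntry_eq_of_acyclic (G := G.fmove e) s (face_sigma_sigma_alpha _) hω
      o'.first_acyclic (fmoveEndOrder_acyclic he o.first_acyclic) (relabel_dual e m hℓ) hℓ').symm

theorem fmoveOp_comp_loopOp [Fintype D] [DecidableEq D] {e : D} (he : ¬ G.IsLoop e)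
    (p : G.Plaquette) (o : G.FusionOrder) (o' : (G.fmove e).FusionOrder) (s : Fin (N + 1)) :
    G.fmoveOp e M ∘ₗ loopOp M o p s =
      loopOp M o' (G.movePlaquette he p) s ∘ₗ G.fmoveOp e M := by
  classical
  obtain ⟨⟨h0, n1, n2⟩, ⟨n3, n4, n5⟩, ⟨n6, n7, n8⟩⟩ := G.ne_of_not_isLoop he
  have a1 := G.σ_ne e
  have a3 := G.sigma_sigma_ne e
  have b1 := G.σ_ne (G.α e)
  have b3 := G.sigma_sigma_ne (G.α e)
  unfold fmoveOp loopOp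
  rw [← Matrix.toLpLin_mul, ← Matrix.toLpLin_mul]
  congr 1
  ext ℓ' ℓ
  rw [Matrix.mul_apply, Matrix.mul_apply]
  simp only [Matrix.of_apply, ite_mul, mul_ite, zero_mul, mul_zero,
    plaquetteEntry_eq_orderedEntry o p s o.first_alpha]
  have hentry := plaquetteEntry_eq_orderedEntry (M := M) o' (G.movePlaquette he p) s
    (ω := o.first) o.first_alpha
  simp only [hentry]
  -- The F-move changes only one edge, so each matrix product collapses to a sum over one label.
  refine Eq.trans (sum_agree_off_edge (G := G) e ℓ' fun ℓ₁ =>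
    M.F (ℓ₁ (G.σ e)) (ℓ₁ (G.σ (G.σ e))) (ℓ₁ e) (ℓ₁ (G.σ (G.α e))) (ℓ₁ (G.σ (G.σ (G.α e)))) (ℓ'.1 e) *
      G.orderedEntry M s (G.face · = p) o.first o.first ℓ₁ ℓ) ?_
  refine Eq.trans (Eq.trans ?_ (fmove_plaquetteEntry he p o o' s ℓ.2 ℓ'.2)) ?_
  · refine Finset.sum_congr rfl fun m _ => ?_
    rw [relabel_self, relabel_of_ne _ _ a1 n1.symm, relabel_of_ne _ _ a3 n2.symm,
      relabel_of_ne _ _ n3 b1, relabel_of_ne _ _ n6 b3]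
  · refine Eq.trans ?_ (Eq.trans (sum_agree_off_edge (G := G) e ℓ fun ℓ₁ =>
      M.F (ℓ.1 (G.σ e)) (ℓ.1 (G.σ (G.σ e))) (ℓ.1 e) (ℓ.1 (G.σ (G.α e)))
        (ℓ.1 (G.σ (G.σ (G.α e)))) (ℓ₁ e) *
      (G.fmove e).orderedEntry M s ((G.fmove e).face · = G.movePlaquette he p) o.first o'.first
        ℓ' ℓ₁).symm ?_)
    · refine Finset.sum_congr rfl fun m _ => ?_
      rw [relabel_self]
    · refine Finset.sum_congr rfl fun ℓ₁ _ => ?_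
      refine if_congr ⟨fun h x h1 h2 => (h x h1 h2).symm, fun h x h1 h2 => (h x h1 h2).symm⟩ ?_ rfl
      exact mul_comm _ _

end TrivalentMap

end

theorem lemma1 {N : ℕ} (M : StringNetModel N) {D : Type*} [Fintype D] [DecidableEq D]
    (G : TrivalentMap D) (e : D) (he : ¬ G.IsLoop e) (p : G.Plaquette)
    (o : G.FusionOrder) (o' : (G.fmove e).FusionOrder) :
    G.fmoveOp e M ∘ₗ TrivalentMap.plaquetteOp M o p =
      TrivalentMap.plaquetteOp M o' (G.movePlaquette he p) ∘ₗ G.fmoveOp e M := by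
  refine LinearMap.ext fun v => ?_
  simp only [TrivalentMap.plaquetteOp, LinearMap.comp_apply, LinearMap.smul_apply,
    LinearMap.sum_apply, map_smul, map_sum]
  exact congrArg _ (Finset.sum_congr rfl fun s _ => congrArg _
    (LinearMap.congr_fun (TrivalentMap.fmoveOp_comp_loopOp he p o o' s) v))
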